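/- Let $n,k,r$ be nonnegative integers with $r\le n$. In $\mathbb{Q}[x_1,\dots,x_n]$ let $e_d$ and $h_d$ denote the elementary and complete homogeneous symmetric polynomials of degree $d$, and let $$I_{n,k,r}=\langle h_{k+1}(x_1,\dots,x_n),\dots,h_{k+n}(x_1,\dots,x_n),\ e_n(x_1,\dots,x_n),e_{n-1}(x_1,\dots,x_n),\dots,e_{n-r+1}(x_1,\dots,x_n)\rangle .$$ Use the lexicographic term order: $x_1^{a_1}\cdots x_n^{a_n}<x_1^{b_1}\cdots x_n^{b_n}$ if for some $i$ we have $a_1=b_1,\dots,a_{i-1}=b_{i-1}$ and $a_i<b_i$. Write $\mathrm{in}_<(f)$ for the leading term of a nonzero polynomial $f$. A finite collection $g_1,\dots,g_t$ of nonzero elements of an ideal $I$ is a Gröbner basis of $I$ if $\langle \mathrm{in}_<(f): f\in I\setminus\{0\}\rangle=\langle \mathrm{in}_<(g_1),\dots,\mathrm{in}_<(g_t)\rangle$; it is minimal if moreover every $g_a$ has leading coefficient $1$ and $\mathrm{in}_<(g_a)\nmid \mathrm{in}_<(g_b)$ for all $a\ne b$. For $\gamma=(\gamma_1,\dots,\gamma_n)$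 a vector of nonnegative integers, the Demazure character $\kappa_\gamma(x_1,\dots,x_n)$ is defined recursively: $\kappa_\gamma=x_1^{\gamma_1}\cdots x_n^{\gamma_n}$ if $\gamma_1\ge\dots\ge\gamma_n$, and if $\gamma_i<\gamma_{i+1}$ then $$\kappa_\gamma=\frac{x_i\,\kappa_{\gamma'}-x_{i+1}\,s_i(\kappa_{\gamma'})}{x_i-x_{i+1}},$$ where $\gamma'$ is $\gamma$ with its $i$-th and $(i+1)$-st entries exchanged and $s_i$ exchanges $x_i$ and $x_{i+1}$ (the result does not depend on the choice of $i$). For $S=\{s_1<\dots<s_m\}\subseteq[n]=\{1,\dots,n\}$ let $\gamma(S)$ be the vector of length $n$ with $\gamma(S)_{s_j}=s_j-j+1$ for $1\le j\le m$ and all other entries $0$, and let $\gamma(S)^*=(\gamma(S)_n,\dots,\gamma(S)_1)$. Then the polynomials $$h_{k+i}(x_i,x_{i+1},\dots,x_n)\qquad(1\le i\le n)$$ together with the polynomials $$\kappa_{\gamma(S)^*}(x_n,x_{n-1},\dots,x_1)\qquad(S\subseteq[n],\ |S|=n-r+1)$$ form a Gröbner basis of $I_{n,k,r}$. If $r<n$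 and $k>0$, this Gröbner basis is minimal. -/

import Mathlib

open MvPolynomial

noncomputable section

/-- The variables `x_1, …, x_n` are `X 0, …, X (n-1)`. The ideal `I_{n,k,r}` of `ℚ[x_1, …, x_n]`
generated by `h_{k+1}, …, h_{k+n}` and `e_{n-r+1}, …, e_n` (all in the full set of variables). -/
def mixedIdeal (n k r : ℕ) : Ideal (MvPolynomial (Fin n) ℚ) :=
  Ideal.span (hsymm (Fin n) ℚ '' Set.Icc (k + 1) (k + n) ∪
    esymm (Fin n) ℚ '' Set.Icc (n - r + 1) n)

/-- `h_d(x_i, x_{i+1}, …, x_n)`, the complete homogeneous symmetric polynomial of degree `d` in the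
variables from `x_i` on. -/
def tailHsymm {n : ℕ} (i : Fin n) (d : ℕ) : MvPolynomial (Fin n) ℚ :=
  rename Subtype.val (hsymm {j : Fin n // i ≤ j} ℚ d)

theorem X_sub_X_dvd_sub_rename_swap {n : ℕ} (i j : Fin n) (p : MvPolynomial (Fin n) ℚ) :
    X i - X j ∣ p - rename (Equiv.swap i j) p := by
  induction p using MvPolynomial.induction_on with
  | C a => simp
  | add p q hp hq =>
    rw [map_add, add_sub_add_comm]
    exact dvd_add hp hq
  | mul_X p l hp =>
    have hl : (X i - X j : MvPolynomial (Fin n) ℚ) ∣ X l - X (Equiv.swap i j l) := by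
      rcases eq_or_ne l i with rfl | hli
      · simp
      rcases eq_or_ne l j with rfl | hlj
      · rw [Equiv.swap_apply_right, ← neg_sub (X i) (X l)]
        exact (dvd_neg).2 dvd_rfl
      · rw [Equiv.swap_apply_of_ne_of_ne hli hlj, sub_self]
        exact dvd_zero _
    have h : p * X l - rename (Equiv.swap i j) (p * X l) =
        (p - rename (Equiv.swap i j) p) * X l +
          rename (Equiv.swap i j) p * (X l - X (Equiv.swap i j l)) := by
      rw [map_mul, rename_X]
      ring
    rw [h]
    exact dvd_add (hp.mul_right _) (hl.mul_left _)

theorem X_sub_X_dvd_demazure {n : ℕ} (i j : Fin n) (f : MvPolynomial (Fin n) ℚ) :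
    X i - X j ∣ X i * f - X j * rename (Equiv.swap i j) f := by
  have h := X_sub_X_dvd_sub_rename_swap i j (X i * f)
  rwa [map_mul, rename_X, Equiv.swap_apply_left] at h

/-- The Demazure operator (isobaric divided difference)
`f ↦ (x_i f - x_j s_{ij}(f)) / (x_i - x_j)`, where `s_{ij}` exchanges `x_i` and `x_j`;
it is used for `i ≠ j` only, where the quotient is unique. -/
def demazureOp {n : ℕ} (i j : Fin n) (f : MvPolynomial (Fin n) ℚ) : MvPolynomial (Fin n) ℚ :=
  (X_sub_X_dvd_demazure i j f).choose

theorem demazureOp_spec {n : ℕ} (i j : Fin n) (f : MvPolynomial (Fin n) ℚ) :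
    (X i - X j) * demazureOp i j f = X i * f - X j * rename (Equiv.swap i j) f :=
  (X_sub_X_dvd_demazure i j f).choose_spec.symm

/-- Exchanging an ascent moves weight to the left; this makes the recursion for Demazure characters
terminate. -/
theorem sum_mul_comp_swap_lt {n : ℕ} (γ : Fin n → ℕ) (i j : Fin n) (hij : i < j)
    (h : γ i < γ j) :
    ∑ l : Fin n, (l : ℕ) * (γ ∘ Equiv.swap i j) l < ∑ l : Fin n, (l : ℕ) * γ l := by
  have hne : i ≠ j := hij.ne
  have hj : j ∈ (Finset.univ : Finset (Fin n)).erase i := by simp [hne.symm]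
  rw [← Finset.add_sum_erase _ _ (Finset.mem_univ i), ← Finset.add_sum_erase _ _ hj,
    ← Finset.add_sum_erase _ (fun l : Fin n => (l : ℕ) * γ l) (Finset.mem_univ i),
    ← Finset.add_sum_erase _ (fun l : Fin n => (l : ℕ) * γ l) hj]
  have hrest : ∑ l ∈ ((Finset.univ : Finset (Fin n)).erase i).erase j,
        (l : ℕ) * (γ ∘ Equiv.swap i j) l =
      ∑ l ∈ ((Finset.univ : Finset (Fin n)).erase i).erase j, (l : ℕ) * γ l := by
    refine Finset.sum_congr rfl fun l hl => ?_
    simp only [Finset.mem_erase, Finset.mem_univ, and_true] at hl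
    rw [Function.comp_apply, Equiv.swap_apply_of_ne_of_ne hl.2 hl.1]
  rw [hrest]
  simp only [Function.comp_apply, Equiv.swap_apply_left, Equiv.swap_apply_right]
  have hij' : (i : ℕ) < j := hij
  nlinarith

/-- The positions `i` with `γ_i < γ_{i+1}`. -/
def ascents {n : ℕ} (γ : Fin n → ℕ) : Finset (Fin n) :=
  Finset.univ.filter fun i => ∃ hi : (i : ℕ) + 1 < n, γ i < γ ⟨i + 1, hi⟩

theorem exists_of_mem_ascents {n : ℕ} {γ : Fin n → ℕ} {i : Fin n} (h : i ∈ ascents γ) :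
    ∃ hi : (i : ℕ) + 1 < n, γ i < γ ⟨i + 1, hi⟩ :=
  (Finset.mem_filter.1 h).2

/-- The Demazure character (key polynomial) `κ_γ(x_1, …, x_n)`: it is the monomial `x^γ` if `γ` is
weakly decreasing, and `σ_i(κ_{γ'})` if `γ_i < γ_{i+1}`, where `γ'` is `γ` with its entries
`i`, `i+1` exchanged and `σ_i` is the Demazure operator. The result does not depend on the ascent
chosen (braid relations for the `σ_i`); here it is the first one. -/
def demazureCharacter {n : ℕ} (γ : Fin n → ℕ) : MvPolynomial (Fin n) ℚ :=
  if h : (ascents γ).Nonempty then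
    let i : Fin n := (ascents γ).min' h
    let j : Fin n := ⟨i + 1, (exists_of_mem_ascents (Finset.min'_mem _ h)).1⟩
    demazureOp i j (demazureCharacter (γ ∘ Equiv.swap i j))
  else ∏ l : Fin n, X l ^ γ l
termination_by ∑ l : Fin n, (l : ℕ) * γ l
decreasing_by
  exact sum_mul_comp_swap_lt γ _ _ (Fin.mk_lt_mk.2 (Nat.lt_succ_self _))
    (exists_of_mem_ascents (Finset.min'_mem _ h)).2

/-- The skip vector `γ(S)`: if `S = {s_1 < ⋯ < s_m}`, then `γ(S)_{s_j} = s_j - j + 1`, and the other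
entries are `0`. The element `i : Fin n` stands for `i + 1 ∈ [n]`, and for `i + 1 = s_j` the number
`j - 1` of smaller elements of `S` is at most `i`, so the subtraction does not truncate. -/
def skipVector {n : ℕ} (S : Finset (Fin n)) (i : Fin n) : ℕ :=
  if i ∈ S then (i : ℕ) + 1 - (S.filter (· < i)).card else 0

/-- `f(x_n, …, x_1)`. -/
def reverseVariables {n : ℕ} (f : MvPolynomial (Fin n) ℚ) : MvPolynomial (Fin n) ℚ :=
  rename Fin.rev f

/-- The initial ideal of `I`, generated by the leading terms of the nonzero elements of `I`. -/
def initialIdeal {n : ℕ} (m : MonomialOrder (Fin n)) (I : Ideal (MvPolynomial (Fin n) ℚ)) :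
    Ideal (MvPolynomial (Fin n) ℚ) :=
  Ideal.span {t | ∃ f ∈ I, f ≠ 0 ∧ t = m.leadingTerm f}

/-- The finite family `g` of nonzero elements of `I` is a Gröbner basis of `I`: the leading terms of
its members generate the initial ideal of `I`. -/
structure IsGroebnerBasis {n : ℕ} (m : MonomialOrder (Fin n)) (I : Ideal (MvPolynomial (Fin n) ℚ))
    {ι : Type} [Finite ι] (g : ι → MvPolynomial (Fin n) ℚ) : Prop where
  mem : ∀ a, g a ∈ I
  ne_zero : ∀ a, g a ≠ 0
  initialIdeal_eq : initialIdeal m I = Ideal.span (Set.range fun a => m.leadingTerm (g a))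

/-- A Gröbner basis is minimal if its members have leading coefficient `1` and no leading term
divides the leading term of another member. -/
structure IsMinimalGroebnerBasis {n : ℕ} (m : MonomialOrder (Fin n))
    (I : Ideal (MvPolynomial (Fin n) ℚ)) {ι : Type} [Finite ι]
    (g : ι → MvPolynomial (Fin n) ℚ) : Prop extends IsGroebnerBasis m I g where
  leadingCoeff_eq_one : ∀ a, m.leadingCoeff (g a) = 1
  not_dvd : ∀ a b, a ≠ b → ¬ m.leadingTerm (g a) ∣ m.leadingTerm (g b)

/-- The polynomials `h_{k+i}(x_i, …, x_n)` for `1 ≤ i ≤ n` together with the variable-reversed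
Demazure characters `κ_{γ(S)^*}(x_n, …, x_1)` for the `(n-r+1)`-element subsets `S` of `[n]`. -/
def mixedGroebnerFamily (n k r : ℕ) :
    Fin n ⊕ {S : Finset (Fin n) // S.card = n - r + 1} → MvPolynomial (Fin n) ℚ
  | .inl i => tailHsymm i (k + (i + 1))
  | .inr S => reverseVariables (demazureCharacter (skipVector S.1 ∘ Fin.rev))

end

/-!
Two facts are needed: the listed polynomials lie in the ideal and have the expected leading terms,
and the ideal has no further leading terms.

For the first, put `m = n - r + 1` and `S = {s_1 < ⋯ < s_m}`. The nonzero entries of `γ(S)^*` are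
weakly decreasing, so the Demazure character is a flagged Schur polynomial, and it equals
`det (h_{s_j + 1 - l}(x_{s_j}, …, x_n))` with `1 ≤ j, l ≤ m`
(`reverseVariables_demazureCharacter_skipVector`). This follows by induction along the recursion: a
Demazure operator moves a nonzero entry past a zero, and in the determinant it only enlarges the set
of variables of one row (`det_flaggedMatrix_update`); when the nonzero entries come first, column
operations make the matrix triangular (`det_flaggedMatrix_of_final`). Combining the columns with the
coefficients `(-1)^a e_a` of `∏ (1 - x_i t)`, `a < m`, gives entries that are, modulo
`e_m, …, e_n`, coefficients of `∏_{i < s_j} (1 - x_i t)` in degree `s_j`, hence zero. As the first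
column enters with coefficient `1`, the determinant lies in the ideal
(`det_flaggedMatrix_mem_mixedIdeal`). Its leading term is the product of the leading terms on the
diagonal (`monic_det_flaggedMatrix`), which is the monomial with exponent `γ(S)`.

For the second, the generators of the ideal are the top degree forms of polynomials vanishing at the
points whose coordinates are distinct elements of `{0, …, n + k - 1}` and include `0, …, r - 1`
(`exists_lower_hsymm`, `exists_lower_esymm`). Hence the standard monomials of the ideal span the
functions on these points, and there are at least as many of them as points
(`standardExponents_eq_of_card_le`), that is at least `n! * choose (n - r + k) (n - r)`. On the
other hand, if a monomial is divisible by none of the leading terms of the family, then a greedy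
search for a set `S` of `m` elements whose monomial `x^{γ(S)}` divides it selects fewer than `m`
positions; counting by the number of positions selected bounds the number of such monomials by the
same quantity (`card_nonskipExponents_le`). So every monomial divisible by none of these leading
terms is standard, which is the Gröbner basis property.
-/

/-! ### Generating series of the elementary and complete homogeneous polynomials -/

/-- The geometric series `1 / (1 - a t)`. -/
noncomputable def geomSeries {A : Type*} [CommRing A] (a : A) : PowerSeries A :=
  PowerSeries.mk fun d => a ^ d

/-- `1 - a t` as a polynomial in `t`. -/
noncomputable def linFactor {A : Type*} [CommRing A] (a : A) : Polynomial A :=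
  1 - Polynomial.C a * Polynomial.X

section
variable {A : Type*} [CommRing A]

theorem linFactor_mul_geomSeries (a : A) :
    (linFactor a : PowerSeries A) * geomSeries a = 1 := by
  ext d
  rw [linFactor, Polynomial.coe_sub, Polynomial.coe_mul, Polynomial.coe_one, Polynomial.coe_C,
    Polynomial.coe_X, sub_mul, one_mul, mul_assoc, map_sub, PowerSeries.coeff_C_mul]
  cases d with
  | zero => simp [geomSeries]
  | succ d =>
    rw [PowerSeries.coeff_succ_X_mul]
    simp [geomSeries, PowerSeries.coeff_one, pow_succ']

theorem natDegree_prod_linFactor_le {ι : Type*} (T : Finset ι) (a : ι → A) :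
    (∏ i ∈ T, linFactor (a i)).natDegree ≤ T.card := by
  refine (Polynomial.natDegree_prod_le _ _).trans ?_
  rw [Finset.card_eq_sum_ones]
  refine Finset.sum_le_sum fun i _ => ?_
  unfold linFactor
  compute_degree

theorem coe_prod_polynomial {ι : Type*} (T : Finset ι) (f : ι → Polynomial A) :
    ((∏ i ∈ T, f i : Polynomial A) : PowerSeries A) = ∏ i ∈ T, (f i : PowerSeries A) :=
  map_prod Polynomial.coeToPowerSeries.ringHom f T

theorem prod_linFactor_mul_prod_geomSeries {ι : Type*} (T : Finset ι) (a : ι → A) :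
    ((∏ i ∈ T, linFactor (a i) : Polynomial A) : PowerSeries A) * ∏ i ∈ T, geomSeries (a i) =
      1 := by
  rw [coe_prod_polynomial, ← Finset.prod_mul_distrib]
  exact Finset.prod_eq_one fun i _ => linFactor_mul_geomSeries _

/-- Clearing denominators: factors `1 - a_i t` with `i ∈ S` cancel the corresponding factors of
the product of geometric series over `S ⊆ T`, leaving the polynomial over `T \ S`. -/
theorem prod_linFactor_mul_prod_geomSeries_of_subset {ι : Type*} [DecidableEq ι] {S T : Finset ι}
    (h : S ⊆ T) (a : ι → A) :
    ((∏ i ∈ T, linFactor (a i) : Polynomial A) : PowerSeries A) * ∏ i ∈ S, geomSeries (a i) =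
      ((∏ i ∈ T \ S, linFactor (a i) : Polynomial A) : PowerSeries A) := by
  rw [← Finset.prod_sdiff h, Polynomial.coe_mul, mul_assoc, prod_linFactor_mul_prod_geomSeries,
    mul_one]

/-- The same cancellation when the denominators are the larger set. -/
theorem prod_linFactor_mul_prod_geomSeries_of_superset {ι : Type*} [DecidableEq ι]
    {S T : Finset ι} (h : T ⊆ S) (a : ι → A) :
    ((∏ i ∈ T, linFactor (a i) : Polynomial A) : PowerSeries A) * ∏ i ∈ S, geomSeries (a i) =
      ∏ i ∈ S \ T, geomSeries (a i) := by
  rw [← Finset.prod_sdiff h, mul_left_comm, prod_linFactor_mul_prod_geomSeries, mul_one]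

theorem map_geomSeries {B : Type*} [CommRing B] (f : A →+* B) (a : A) :
    PowerSeries.map f (geomSeries a) = geomSeries (f a) := by
  ext d
  simp [geomSeries]

/-- A coefficient of a product of a polynomial and a power series, as a linear combination of
coefficients of shifted power series. -/
theorem sum_coeff_X_pow_mul (P : Polynomial A) (H : PowerSeries A) {N : ℕ} (h : P.natDegree < N)
    (c : ℕ) :
    ∑ l ∈ Finset.range N, PowerSeries.coeff c (PowerSeries.X ^ l * H) * P.coeff l =
      PowerSeries.coeff c ((P : PowerSeries A) * H) := by
  have hP : (P : PowerSeries A) =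
      ∑ l ∈ Finset.range N, PowerSeries.C (P.coeff l) * PowerSeries.X ^ l := by
    conv_lhs => rw [P.as_sum_range_C_mul_X_pow' h]
    rw [← Polynomial.coeToPowerSeries.ringHom_apply, map_sum]
    simp
  rw [hP, Finset.sum_mul, map_sum]
  refine Finset.sum_congr rfl fun l _ => ?_
  rw [mul_assoc, PowerSeries.coeff_C_mul, mul_comm]

theorem coeff_prod_linFactor {ι : Type*} (T : Finset ι) (a : ι → A) (d : ℕ) :
    (∏ i ∈ T, linFactor (a i)).coeff d =
      (-1) ^ d * ∑ t ∈ T.powersetCard d, ∏ i ∈ t, a i := by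
  have h : ∀ i, linFactor (a i) = 1 + Polynomial.C (-a i) * Polynomial.X := by
    intro i
    simp [linFactor, sub_eq_add_neg]
  simp_rw [h]
  classical
  rw [Finset.prod_one_add, Polynomial.finsetSum_coeff, Finset.mul_sum,
    ← Finset.sum_subset (s₁ := T.powersetCard d) fun t ht =>
      Finset.mem_powerset.2 (Finset.mem_powersetCard.1 ht).1]
  · refine Finset.sum_congr rfl fun t ht => ?_
    rw [Finset.prod_mul_distrib, Finset.prod_const, ← map_prod, (Finset.mem_powersetCard.1 ht).2,
      Polynomial.coeff_C_mul_X_pow, if_pos rfl, Finset.prod_neg, (Finset.mem_powersetCard.1 ht).2]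
  · intro t ht ht'
    rw [Finset.prod_mul_distrib, Finset.prod_const, ← map_prod, Polynomial.coeff_C_mul_X_pow,
      if_neg]
    rintro rfl
    exact ht' (Finset.mem_powersetCard.2 ⟨Finset.mem_powerset.1 ht, rfl⟩)

end

section
variable {n : ℕ}

/-- `∏_{i ∈ T} 1 / (1 - x_i t)`, the generating series of the complete homogeneous symmetric
polynomials in the variables of `T`. -/
noncomputable def completeSeries (T : Finset (Fin n)) : PowerSeries (MvPolynomial (Fin n) ℚ) :=
  ∏ i ∈ T, geomSeries (X i)

/-- `∏_{i ∈ T} (1 - x_i t)`, the generating polynomial of the elementary symmetric polynomials in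
the variables of `T`, with alternating signs. -/
noncomputable def elemPolynomial (T : Finset (Fin n)) : Polynomial (MvPolynomial (Fin n) ℚ) :=
  ∏ i ∈ T, linFactor (X i)

theorem coeff_elemPolynomial_univ (d : ℕ) :
    (elemPolynomial (Finset.univ : Finset (Fin n))).coeff d = (-1) ^ d * esymm (Fin n) ℚ d := by
  rw [elemPolynomial, coeff_prod_linFactor, esymm]

theorem coeff_completeSeries (T : Finset (Fin n)) (d : ℕ) :
    PowerSeries.coeff d (completeSeries T) =
      ∑ l ∈ T.finsuppAntidiag d, monomial l (1 : ℚ) := by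
  rw [completeSeries, PowerSeries.coeff_prod]
  refine Finset.sum_congr rfl fun l hl => ?_
  rw [monomial_eq, C_1, one_mul, Finsupp.prod_of_support_subset _
    (Finset.mem_finsuppAntidiag.1 hl).2 _ (by simp)]
  simp [geomSeries]

theorem coeff_completeSeries_eq_rename (T : Finset (Fin n)) (d : ℕ) :
    PowerSeries.coeff d (completeSeries T) =
      rename Subtype.val (hsymm {j // j ∈ T} ℚ d) := by
  rw [coeff_completeSeries, hsymm, map_sum, ← Finset.sum_coe_sort]
  refine Fintype.sum_equiv (Finset.finsuppAntidiagEquiv T d) _ _ fun l => ?_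
  have hl := Finset.mem_finsuppAntidiag.1 l.2
  set f := Finset.finsuppAntidiagEquiv T d l with hf
  rw [map_multiset_prod, Multiset.map_map, Finset.prod_multiset_map_count]
  rw [monomial_eq, C_1, one_mul, Finsupp.prod_of_support_subset _ hl.2 _ (by simp),
    ← Finset.prod_coe_sort]
  have hcount : ∀ a : T, f.1.count a = l.1 a := fun a =>
    Finset.count_coe_finsuppAntidiagEquiv_apply d l a
  rw [← Finset.prod_subset (Finset.subset_univ f.1.toFinset)]
  · refine Finset.prod_congr rfl fun a _ => ?_
    rw [hcount, Function.comp_apply, rename_X]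
  · intro a _ ha
    rw [← hcount, Multiset.count_eq_zero_of_notMem fun h => ha (Multiset.mem_toFinset.2 h),
      pow_zero]

theorem tailHsymm_eq_coeff (i : Fin n) (d : ℕ) :
    tailHsymm i d = PowerSeries.coeff d (completeSeries (Finset.Ici i)) := by
  rw [coeff_completeSeries_eq_rename, tailHsymm]
  let e : {j : Fin n // i ≤ j} ≃ {j // j ∈ Finset.Ici i} :=
    Equiv.subtypeEquivRight fun j => Finset.mem_Ici.symm
  rw [← rename_hsymm _ _ d e, rename_rename]
  rfl

theorem hsymm_eq_coeff (d : ℕ) :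
    hsymm (Fin n) ℚ d = PowerSeries.coeff d (completeSeries (Finset.univ : Finset (Fin n))) := by
  rw [coeff_completeSeries_eq_rename]
  let e : Fin n ≃ {j // j ∈ (Finset.univ : Finset (Fin n))} :=
    (Equiv.subtypeUnivEquiv fun j => Finset.mem_univ j).symm
  rw [← rename_hsymm _ _ d e, rename_rename]
  exact (rename_id_apply _).symm

end

/-! ### Standard monomials and deformation of ideals -/

section
variable {n : ℕ}

/-- The exponents of the standard monomials of `I`: those that are not the degree of any nonzero
element of `I`. -/
def standardExponents (m : MonomialOrder (Fin n)) (I : Ideal (MvPolynomial (Fin n) ℚ)) :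
    Set (Fin n →₀ ℕ) :=
  {u | ∀ f ∈ I, f ≠ 0 → m.degree f ≠ u}

/-- The standard monomials of an ideal span the polynomial ring modulo the ideal. -/
theorem sup_restrictSupport_standardExponents (m : MonomialOrder (Fin n))
    (I : Ideal (MvPolynomial (Fin n) ℚ)) :
    I.restrictScalars ℚ ⊔ restrictSupport ℚ (standardExponents m I) = ⊤ := by
  rw [eq_top_iff]
  set W := I.restrictScalars ℚ ⊔ restrictSupport ℚ (standardExponents m I) with hW
  -- Induction on the degree: subtracting from `f` a multiple of an element of `W` of the same
  -- degree leaves zero or a polynomial of smaller degree.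
  have key : ∀ u : m.syn, ∀ f : MvPolynomial (Fin n) ℚ, m.toSyn (m.degree f) = u → f ∈ W := by
    intro u
    induction u using WellFoundedLT.induction with
    | ind u ih =>
      intro f hf
      have hlead : ∃ g ∈ W, m.degree g = m.degree f ∧ m.leadingCoeff g = 1 := by
        by_cases hs : m.degree f ∈ standardExponents m I
        · refine ⟨monomial (m.degree f) 1, ?_, ?_, ?_⟩
          · refine Submodule.mem_sup_right ?_
            rw [mem_restrictSupport_iff]
            intro v hv
            have := support_monomial_subset hv
            rw [Finset.mem_singleton] at this
            rwa [this]
          · rw [m.degree_monomial, if_neg one_ne_zero]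
          · rw [m.leadingCoeff_monomial]
        · simp only [standardExponents, Set.mem_ofPred_eq, not_forall, not_not] at hs
          obtain ⟨g, hgI, hg0, hg⟩ := hs
          have hc : m.leadingCoeff g ≠ 0 := m.leadingCoeff_ne_zero_iff.2 hg0
          refine ⟨C (m.leadingCoeff g)⁻¹ * g, Submodule.mem_sup_left (I.mul_mem_left _ hgI), ?_, ?_⟩
          · rw [m.degree_mul (by simpa using hc) hg0, m.degree_C, zero_add, hg]
          · rw [m.leadingCoeff_mul, m.leadingCoeff_C, inv_mul_cancel₀ hc]
      obtain ⟨g, hgW, hgd, hgc⟩ := hlead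
      set r := f - m.leadingCoeff f • g with hr
      have hfr : f = r + m.leadingCoeff f • g := by rw [hr]; ring
      have hrW : r ∈ W := by
        by_cases h0 : r = 0
        · rw [h0]; exact W.zero_mem
        refine ih (m.toSyn (m.degree r)) ?_ r rfl
        have hle : m.toSyn (m.degree r) ≤ u := by
          rw [← hf]
          refine m.degree_sub_le.trans (sup_le le_rfl ?_)
          refine m.degree_smul_le.trans ?_
          rw [hgd]
        refine lt_of_le_of_ne hle fun he => ?_
        have hdeg : m.degree r = m.degree f := m.toSyn.injective (he.trans hf.symm)
        have : r.coeff (m.degree r) = 0 := by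
          rw [hdeg, hr, coeff_sub, coeff_smul, ← hgd]
          change f.coeff _ - m.leadingCoeff f • m.leadingCoeff g = 0
          rw [hgc, hgd]
          simp [MonomialOrder.leadingCoeff]
        exact m.coeff_degree_ne_zero_iff.2 h0 this
      rw [hfr]
      exact W.add_mem hrW (W.smul_mem _ hgW)
  exact fun f _ => key _ f rfl

/-- Let `I` be generated by homogeneous polynomials each of which is congruent modulo `J` to a
polynomial of smaller degree. If a space `B` closed under taking homogeneous components spans the
polynomial ring modulo `I`, then it also does so modulo `J`. -/
theorem sup_eq_top_of_lower_terms {G : Set (MvPolynomial (Fin n) ℚ)}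
    {J : Ideal (MvPolynomial (Fin n) ℚ)} {B : Submodule ℚ (MvPolynomial (Fin n) ℚ)}
    (hB : ∀ p ∈ B, ∀ d, homogeneousComponent d p ∈ B)
    (hG : ∀ g ∈ G, ∃ D, g.IsHomogeneous D ∧
      ∃ q ∈ ⨆ d ∈ Set.Iio D, homogeneousSubmodule (Fin n) ℚ d, g - q ∈ J)
    (h : (Ideal.span G).restrictScalars ℚ ⊔ B = ⊤) :
    J.restrictScalars ℚ ⊔ B = ⊤ := by
  set W := J.restrictScalars ℚ ⊔ B with hW
  have hom : ∀ d, homogeneousSubmodule (Fin n) ℚ d ≤ W := by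
    intro d
    induction d using Nat.strong_induction_on with
    | _ d ih =>
    -- In a product of a homogeneous polynomial with a generator `g ≡ q`, the generator may be
    -- replaced by `q`, whose degree is smaller, so that the induction hypothesis applies.
    have comp : ∀ i ∈ Ideal.span G, homogeneousComponent d i ∈ W := by
      intro i hi
      induction hi using Submodule.closure_induction with
      | zero => rw [map_zero]; exact W.zero_mem
      | add x y _ _ hx hy => rw [map_add]; exact W.add_mem hx hy
      | smul_mem a g hg =>
        obtain ⟨D, hgD, q, hq, hgq⟩ := hG g hg
        rw [smul_eq_mul, ← sum_homogeneousComponent a, Finset.sum_mul, map_sum]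
        refine W.sum_mem fun e _ => ?_
        have he := (homogeneousComponent_isHomogeneous e a).mul hgD
        rw [homogeneousComponent_of_mem he]
        split_ifs with hde
        · subst hde
          have hsplit : homogeneousComponent e a * g =
              homogeneousComponent e a * (g - q) + homogeneousComponent e a * q := by ring
          rw [hsplit]
          refine W.add_mem (Submodule.mem_sup_left (J.mul_mem_left _ hgq)) ?_
          have hle : ⨆ d ∈ Set.Iio D, homogeneousSubmodule (Fin n) ℚ d ≤
              W.comap (LinearMap.mulLeft ℚ (homogeneousComponent e a)) :=
            iSup₂_le fun d hd p hp => ih (e + d) (Nat.add_lt_add_left hd e)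
              ((homogeneousComponent_isHomogeneous e a).mul hp)
          exact hle hq
        · exact W.zero_mem
    intro p hp
    obtain ⟨i, hi, b, hb, hib⟩ := Submodule.mem_sup.1 (h ▸ Submodule.mem_top : p ∈ _ ⊔ B)
    have hpd : homogeneousComponent d p = p := by
      rw [homogeneousComponent_of_mem hp, if_pos rfl]
    rw [← hpd, ← hib, map_add]
    exact W.add_mem (comp i hi) (Submodule.mem_sup_right (hB b hb d))
  rw [eq_top_iff]
  intro p _
  rw [← sum_homogeneousComponent p]
  exact W.sum_mem fun d _ => hom d (homogeneousComponent_isHomogeneous d p)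

/-- Every function on a finite set of points is the restriction of a polynomial. -/
theorem exists_eval_eq {ι : Type*} [Finite ι] (pt : ι → Fin n → ℚ) (hpt : Function.Injective pt)
    (v : ι → ℚ) : ∃ p : MvPolynomial (Fin n) ℚ, ∀ y, eval (pt y) p = v y := by
  classical
  have := Fintype.ofFinite ι
  have hsep : ∀ y z : ι, ∃ p : MvPolynomial (Fin n) ℚ,
      z ≠ y → eval (pt y) p = 1 ∧ eval (pt z) p = 0 := by
    intro y z
    by_cases h : z = y
    · exact ⟨0, fun h' => absurd h h'⟩
    · obtain ⟨i, hi⟩ := Function.ne_iff.1 (hpt.ne h)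
      refine ⟨C (pt y i - pt z i)⁻¹ * (X i - C (pt z i)), fun _ => ⟨?_, ?_⟩⟩
      · simp [inv_mul_cancel₀ (sub_ne_zero.2 hi.symm)]
      · simp
  choose s hs using hsep
  refine ⟨∑ y, C (v y) * ∏ z ∈ Finset.univ.erase y, s y z, fun w => ?_⟩
  rw [map_sum, Finset.sum_eq_single w]
  · rw [map_mul, map_prod, eval_C, Finset.prod_eq_one, mul_one]
    exact fun z hz => (hs w z (Finset.ne_of_mem_erase hz)).1
  · intro y _ hy
    rw [map_mul, map_prod, Finset.prod_eq_zero (i := w), mul_zero]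
    · exact Finset.mem_erase.2 ⟨hy.symm, Finset.mem_univ _⟩
    · exact (hs y w hy.symm).2
  · exact fun h => absurd (Finset.mem_univ w) h

/-- The evaluation of polynomials at a family of points. -/
noncomputable def evalAt {ι : Type*} (pt : ι → Fin n → ℚ) :
    MvPolynomial (Fin n) ℚ →ₐ[ℚ] (ι → ℚ) :=
  AlgHom.pi fun y => aeval (pt y)

theorem evalAt_apply {ι : Type*} (pt : ι → Fin n → ℚ) (p : MvPolynomial (Fin n) ℚ) (y : ι) :
    evalAt pt p y = eval (pt y) p := by
  simp [evalAt, aeval_eq_eval]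

/-- A finite set of exponents whose monomials span the functions on a finite set of points is at
least as large as the set of points. -/
theorem card_le_of_map_restrictSupport_eq_top {ι : Type*} [Fintype ι] {pt : ι → Fin n → ℚ}
    {B : Finset (Fin n →₀ ℕ)}
    (h : (restrictSupport ℚ (B : Set (Fin n →₀ ℕ))).map (evalAt pt).toLinearMap = ⊤) :
    Fintype.card ι ≤ B.card := by
  classical
  rw [restrictSupport_eq_span, Submodule.map_span, Set.image_image, ← Finset.coe_image] at h
  have h1 := finrank_span_finset_le_card (R := ℚ)
    (B.image fun u => (evalAt pt).toLinearMap (monomial u (1 : ℚ)))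
  rw [Set.finrank, h, finrank_top, Module.finrank_fintype_fun_eq_card] at h1
  exact h1.trans Finset.card_image_le

/-- If the generators of an ideal `I` are the top degree forms of polynomials vanishing on a set of
points, then a set of at most as many exponents as there are points, containing the standard
exponents of `I`, consists of the standard exponents only. -/
theorem standardExponents_eq_of_card_le {ι : Type*} [Fintype ι] {pt : ι → Fin n → ℚ}
    (hpt : Function.Injective pt) (m : MonomialOrder (Fin n)) {G : Set (MvPolynomial (Fin n) ℚ)}
    (hG : ∀ g ∈ G, ∃ D, g.IsHomogeneous D ∧
      ∃ q ∈ ⨆ d ∈ Set.Iio D, homogeneousSubmodule (Fin n) ℚ d, evalAt pt (g - q) = 0)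
    {M : Finset (Fin n →₀ ℕ)} (hM : standardExponents m (Ideal.span G) ⊆ M)
    (hcard : M.card ≤ Fintype.card ι) : standardExponents m (Ideal.span G) = M := by
  have hspan := sup_restrictSupport_standardExponents m (Ideal.span G)
  obtain ⟨B, hB⟩ := (M.finite_toSet.subset hM).exists_finset_coe
  rw [← hB] at hM hspan ⊢
  have htop := sup_eq_top_of_lower_terms (J := RingHom.ker (evalAt pt)) ?_ hG hspan
  · have hmap : (restrictSupport ℚ (B : Set (Fin n →₀ ℕ))).map (evalAt pt).toLinearMap = ⊤ := by
      rw [eq_top_iff]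
      intro v _
      obtain ⟨p, hp⟩ := exists_eval_eq pt hpt v
      obtain ⟨i, hi, b, hb, hib⟩ := Submodule.mem_sup.1 (htop.ge (Submodule.mem_top (x := p)))
      have hi0 : evalAt pt i = 0 := RingHom.mem_ker.1 hi
      have hbp : evalAt pt b = evalAt pt p := by rw [← hib, map_add, hi0, zero_add]
      refine ⟨b, hb, ?_⟩
      ext y
      rw [AlgHom.toLinearMap_apply, hbp, evalAt_apply, hp]
    rw [Finset.eq_of_subset_of_card_le (Finset.coe_subset.1 hM)
      (hcard.trans (card_le_of_map_restrictSupport_eq_top hmap))]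
  · intro p hp d
    rw [mem_restrictSupport_iff] at hp ⊢
    intro u hu
    refine hp ?_
    rw [Finset.mem_coe, mem_support_iff, coeff_homogeneousComponent] at hu
    exact mem_support_iff.2 fun h => hu (by rw [h, ite_self])

end

/-! ### A determinantal formula for Demazure characters -/

section
variable {n m : ℕ}

/-- The flagged Jacobi–Trudi matrix with entries `h_{c_j - l}(x_{s_j}, …, x_n)`, where `l` runs
through `0, …, m - 1`. Writing the entries as coefficients of shifted power series makes those of
negative degree vanish. -/
noncomputable def flaggedMatrix (c : Fin m → ℕ) (s : Fin m → Fin n) :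
    Matrix (Fin m) (Fin m) (MvPolynomial (Fin n) ℚ) :=
  Matrix.of fun j l =>
    PowerSeries.coeff (c j) (PowerSeries.X ^ (l : ℕ) * completeSeries (Finset.Ici (s j)))

theorem flaggedMatrix_apply (c : Fin m → ℕ) (s : Fin m → Fin n) (j l : Fin m) :
    flaggedMatrix c s j l =
      PowerSeries.coeff (c j) (PowerSeries.X ^ (l : ℕ) * completeSeries (Finset.Ici (s j))) :=
  rfl

/-- If the flags are the last `m` indices, unitriangular column operations by elementary symmetric
polynomials make the flagged matrix triangular, and its determinant is a monomial. -/
theorem det_flaggedMatrix_of_final {c : Fin m → ℕ} {s : Fin m → Fin n}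
    (hs : ∀ j, (s j : ℕ) + m = n + j) (hc : ∀ j : Fin m, (j : ℕ) ≤ c j) :
    (flaggedMatrix c s).det = ∏ j, X (s j) ^ (c j - j) := by
  let P : Fin m → Polynomial (MvPolynomial (Fin n) ℚ) := fun l =>
    Polynomial.X ^ (l : ℕ) * elemPolynomial (Finset.Ioi (s l))
  let U : Matrix (Fin m) (Fin m) (MvPolynomial (Fin n) ℚ) := Matrix.of fun l' l => (P l).coeff l'
  have hU : U.det = 1 := by
    rw [Matrix.det_of_isLowerTriangular U]
    · refine Finset.prod_eq_one fun l _ => ?_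
      change (P l).coeff l = 1
      rw [Polynomial.coeff_X_pow_mul', if_pos le_rfl, Nat.sub_self, elemPolynomial,
        coeff_prod_linFactor]
      simp
    · intro l' l hl
      change (P l).coeff l' = 0
      rw [Polynomial.coeff_X_pow_mul', if_neg]
      exact not_le.2 hl
  have hMU : ∀ j l, (flaggedMatrix c s * U) j l = PowerSeries.coeff (c j)
      (PowerSeries.X ^ (l : ℕ) * ((elemPolynomial (Finset.Ioi (s l)) : PowerSeries _) *
        completeSeries (Finset.Ici (s j)))) := by
    intro j l
    have hdeg : (P l).natDegree < m := by
      refine (Polynomial.natDegree_mul_le.trans (add_le_add (Polynomial.natDegree_X_pow_le _)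
        (natDegree_prod_linFactor_le _ _))).trans_lt ?_
      rw [Fin.card_Ioi]
      have := hs l
      omega
    rw [← mul_assoc, ← Polynomial.coe_X, ← Polynomial.coe_pow, ← Polynomial.coe_mul,
      ← sum_coeff_X_pow_mul _ _ hdeg, ← Fin.sum_univ_eq_sum_range
        (fun i => PowerSeries.coeff (c j) (PowerSeries.X ^ i * completeSeries (Finset.Ici (s j))) *
          (P l).coeff i)]
    rfl
  rw [← mul_one (flaggedMatrix c s).det, ← hU, ← Matrix.det_mul, Matrix.det_of_isUpperTriangular]
  · refine Finset.prod_congr rfl fun j _ => ?_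
    rw [hMU, elemPolynomial, completeSeries, prod_linFactor_mul_prod_geomSeries_of_superset
      Finset.Ioi_subset_Ici_self]
    have : Finset.Ici (s j) \ Finset.Ioi (s j) = {s j} := by
      ext i
      simp only [Finset.mem_sdiff, Finset.mem_Ici, Finset.mem_Ioi, Finset.mem_singleton]
      exact ⟨fun h => le_antisymm (not_lt.1 h.2) h.1, fun h => ⟨h.ge, h.le.not_gt⟩⟩
    rw [this, Finset.prod_singleton, PowerSeries.coeff_X_pow_mul', if_pos (hc j), geomSeries,
      PowerSeries.coeff_mk]
  · intro j l hl
    have hl : l < j := hl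
    have hsl := hs l
    have hsj := hs j
    have hlj : (l : ℕ) < j := hl
    have hsub : Finset.Ici (s j) ⊆ Finset.Ioi (s l) := by
      intro i hi
      rw [Finset.mem_Ici, Fin.le_def] at hi
      rw [Finset.mem_Ioi, Fin.lt_def]
      omega
    rw [hMU, elemPolynomial, completeSeries, prod_linFactor_mul_prod_geomSeries_of_subset hsub,
      PowerSeries.coeff_X_pow_mul']
    split_ifs
    · rw [Polynomial.coeff_coe, Polynomial.coeff_eq_zero_of_natDegree_lt]
      refine (natDegree_prod_linFactor_le _ _).trans_lt ?_
      rw [Finset.card_sdiff_of_subset hsub, Fin.card_Ioi, Fin.card_Ici]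
      have := hc j
      omega
    · rfl

/-- The effect of permuting the variables on a product of geometric series. -/
theorem map_rename_completeSeries (e : Equiv.Perm (Fin n)) (T : Finset (Fin n)) :
    PowerSeries.map (rename e : MvPolynomial (Fin n) ℚ →ₐ[ℚ] _).toRingHom (completeSeries T) =
      completeSeries (T.map e.toEmbedding) := by
  rw [completeSeries, completeSeries, map_prod, Finset.prod_map]
  refine Finset.prod_congr rfl fun i _ => ?_
  rw [map_geomSeries]
  simp

theorem rename_coeff_completeSeries (e : Equiv.Perm (Fin n)) (T : Finset (Fin n)) (c l : ℕ) :
    rename e (PowerSeries.coeff c (PowerSeries.X ^ l * completeSeries T)) =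
      PowerSeries.coeff c (PowerSeries.X ^ l * completeSeries (T.map e.toEmbedding)) := by
  rw [← map_rename_completeSeries, ← PowerSeries.map_X
    (rename e : MvPolynomial (Fin n) ℚ →ₐ[ℚ] _).toRingHom, ← map_pow, ← map_mul,
    PowerSeries.coeff_map]
  simp

theorem map_swap_Ici_of_ne {u v b : Fin n} (huv : (v : ℕ) = u + 1) (hb : b ≠ v) :
    (Finset.Ici b).map (Equiv.swap v u).toEmbedding = Finset.Ici b := by
  ext i
  rw [Finset.mem_map_equiv, Equiv.symm_swap, Finset.mem_Ici, Finset.mem_Ici]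
  have hb' : (b : ℕ) ≠ v := fun h => hb (Fin.ext h)
  rcases eq_or_ne i v with rfl | hv
  · rw [Equiv.swap_apply_left, Fin.le_def, Fin.le_def]
    omega
  rcases eq_or_ne i u with rfl | hu
  · rw [Equiv.swap_apply_right, Fin.le_def, Fin.le_def]
    omega
  · rw [Equiv.swap_apply_of_ne_of_ne hv hu]

/-- The identity `(x_v - x_u) / ((1 - x_u t) (1 - x_v t)) = x_v / (1 - x_v t) - x_u / (1 - x_u t)`,
multiplied by the series of the variables after `x_v`. -/
theorem completeSeries_swap_identity {u v : Fin n} (huv : (v : ℕ) = u + 1) :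
    PowerSeries.C (X v - X u) * completeSeries (Finset.Ici u) =
      PowerSeries.C (X v) * completeSeries (Finset.Ici v) -
        PowerSeries.C (X u) *
          completeSeries ((Finset.Ici v).map (Equiv.swap v u).toEmbedding) := by
  have hIv : Finset.Ici v = insert v (Finset.Ioi v) := by
    ext i
    simp only [Finset.mem_insert, Finset.mem_Ici, Finset.mem_Ioi]
    rw [le_iff_eq_or_lt, eq_comm]
  have hIu : Finset.Ici u = insert u (Finset.Ici v) := by
    ext i
    simp only [Finset.mem_insert, Finset.mem_Ici, Fin.le_def, Fin.ext_iff]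
    omega
  have hTi : (Finset.Ici v).map (Equiv.swap v u).toEmbedding = insert u (Finset.Ioi v) := by
    ext i
    rw [Finset.mem_map_equiv, Equiv.symm_swap, Finset.mem_Ici, Finset.mem_insert,
      Finset.mem_Ioi]
    rcases eq_or_ne i v with rfl | h1
    · rw [Equiv.swap_apply_left]
      simp only [Fin.le_def, Fin.lt_def, Fin.ext_iff]
      omega
    rcases eq_or_ne i u with rfl | h2
    · simp
    · rw [Equiv.swap_apply_of_ne_of_ne h1 h2]
      simp only [Fin.le_def, Fin.lt_def, Fin.ext_iff, ne_eq] at *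
      omega
  have hu' : u ∉ Finset.Ici v := by
    rw [Finset.mem_Ici, Fin.le_def]; omega
  have hu'' : u ∉ Finset.Ioi v := fun h => hu' (Finset.Ioi_subset_Ici_self h)
  rw [hIu, hTi, completeSeries, completeSeries, completeSeries, Finset.prod_insert hu',
    hIv, Finset.prod_insert Finset.notMem_Ioi_self, Finset.prod_insert hu'']
  have eu := linFactor_mul_geomSeries (X u : MvPolynomial (Fin n) ℚ)
  have ev := linFactor_mul_geomSeries (X v : MvPolynomial (Fin n) ℚ)
  simp only [linFactor, Polynomial.coe_sub, Polynomial.coe_one, Polynomial.coe_mul,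
    Polynomial.coe_C, Polynomial.coe_X] at eu ev
  rw [map_sub]
  set gu := geomSeries (X u : MvPolynomial (Fin n) ℚ)
  set gv := geomSeries (X v : MvPolynomial (Fin n) ℚ)
  set Q := ∏ i ∈ Finset.Ioi v, geomSeries (X i : MvPolynomial (Fin n) ℚ)
  set xu := PowerSeries.C (X u : MvPolynomial (Fin n) ℚ)
  set xv := PowerSeries.C (X v : MvPolynomial (Fin n) ℚ)
  linear_combination (xv * gv * Q) * eu - (xu * gu * Q) * ev

theorem coeff_X_pow_mul_C_mul {A : Type*} [CommRing A] (c l : ℕ) (a : A) (F : PowerSeries A) :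
    PowerSeries.coeff c (PowerSeries.X ^ l * (PowerSeries.C a * F)) =
      a * PowerSeries.coeff c (PowerSeries.X ^ l * F) := by
  rw [mul_left_comm, PowerSeries.coeff_C_mul]

/-- The Demazure operator moves a flag by one step. All other rows of the flagged matrix are
symmetric in the two variables exchanged. -/
theorem det_flaggedMatrix_update (c : Fin m → ℕ) {s : Fin m → Fin n} (a : Fin m) {u v : Fin n}
    (huv : (v : ℕ) = u + 1) (hu : s a = u) (hv : ∀ b, s b ≠ v) :
    (X v - X u) * (flaggedMatrix c s).det =
      X v * (flaggedMatrix c (Function.update s a v)).det -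
        X u * rename (Equiv.swap v u) (flaggedMatrix c (Function.update s a v)).det := by
  let row : Finset (Fin n) → Fin m → MvPolynomial (Fin n) ℚ := fun T l =>
    PowerSeries.coeff (c a) (PowerSeries.X ^ (l : ℕ) * completeSeries T)
  have h1 : (flaggedMatrix c s).det =
      ((flaggedMatrix c s).updateRow a (row (Finset.Ici u))).det := by
    congr 1
    ext j l : 2
    rcases eq_or_ne j a with rfl | hj
    · rw [Matrix.updateRow_self, flaggedMatrix_apply, hu]
    · rw [Matrix.updateRow_ne hj]
  have h2 : (flaggedMatrix c (Function.update s a v)).det =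
      ((flaggedMatrix c s).updateRow a (row (Finset.Ici v))).det := by
    congr 1
    ext j l : 2
    rcases eq_or_ne j a with rfl | hj
    · rw [Matrix.updateRow_self, flaggedMatrix_apply, Function.update_self]
    · rw [Matrix.updateRow_ne hj, flaggedMatrix_apply, flaggedMatrix_apply,
        Function.update_of_ne hj]
  set T := (Finset.Ici v).map (Equiv.swap v u).toEmbedding with hT
  have h3 : rename (Equiv.swap v u) (flaggedMatrix c (Function.update s a v)).det =
      ((flaggedMatrix c s).updateRow a (row T)).det := by
    rw [h2, AlgHom.map_det]
    congr 1
    ext j l : 2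
    rw [AlgHom.mapMatrix_apply, Matrix.map_apply]
    rcases eq_or_ne j a with rfl | hj
    · rw [Matrix.updateRow_self, Matrix.updateRow_self, rename_coeff_completeSeries]
    · rw [Matrix.updateRow_ne hj, Matrix.updateRow_ne hj, flaggedMatrix_apply,
        rename_coeff_completeSeries, map_swap_Ici_of_ne huv (hv j)]
  have hrow : (X v - X u : MvPolynomial (Fin n) ℚ) • row (Finset.Ici u) =
      (X v : MvPolynomial (Fin n) ℚ) • row (Finset.Ici v) +
        (-X u : MvPolynomial (Fin n) ℚ) • row T := by
    have hser := completeSeries_swap_identity huv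
    rw [← hT] at hser
    funext l
    simp only [Pi.smul_apply, Pi.add_apply, smul_eq_mul, row]
    rw [← coeff_X_pow_mul_C_mul, hser, mul_sub, map_sub, coeff_X_pow_mul_C_mul,
      coeff_X_pow_mul_C_mul, neg_mul, sub_eq_add_neg]
  rw [h1, h3, h2, ← Matrix.det_updateRow_smul, hrow, Matrix.det_updateRow_add,
    Matrix.det_updateRow_smul, Matrix.det_updateRow_smul]
  ring

end

section
variable {n m : ℕ}

theorem reverseVariables_demazureOp (i j : Fin n) (f : MvPolynomial (Fin n) ℚ) :
    (X i.rev - X j.rev) * reverseVariables (demazureOp i j f) =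
      X i.rev * reverseVariables f -
        X j.rev * rename (Equiv.swap i.rev j.rev) (reverseVariables f) := by
  have h := congrArg (rename Fin.rev) (demazureOp_spec i j f)
  simp only [map_mul, map_sub, rename_X, rename_rename] at h
  rw [reverseVariables, reverseVariables, h, rename_rename]
  congr 4
  funext l
  exact (Fin.revPerm.injective.swap_apply i j l).symm

/-- A strictly increasing sequence of indices whose range is closed under successors consists of
the last indices. -/
theorem add_eq_of_range_succ_closed {s : Fin m → Fin n} (hs : StrictMono s)
    (hsucc : ∀ (x : Fin n) (hx : (x : ℕ) + 1 < n), x ∈ Set.range s → ⟨x + 1, hx⟩ ∈ Set.range s)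
    (j : Fin m) : (s j : ℕ) + m = n + j := by
  have hup : ∀ y : ℕ, ∀ hy : y < n, (s j : ℕ) ≤ y → (⟨y, hy⟩ : Fin n) ∈ Set.range s := by
    intro y hy hle
    induction y, hle using Nat.le_induction with
    | base => exact ⟨j, rfl⟩
    | succ y hle ih => exact hsucc ⟨y, by omega⟩ hy (ih (by omega))
  have himg : Finset.Ici (s j) = (Finset.Ici j).image s := by
    ext y
    rw [Finset.mem_Ici, Finset.mem_image]
    constructor
    · intro h
      obtain ⟨l, hl⟩ := hup y y.2 h
      exact ⟨l, Finset.mem_Ici.2 (hs.le_iff_le.1 (by rw [hl]; exact h)), hl⟩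
    · rintro ⟨l, hl, rfl⟩
      exact hs.monotone (Finset.mem_Ici.1 hl)
  have hcard := congrArg Finset.card himg
  rw [Finset.card_image_of_injective _ hs.injective, Fin.card_Ici, Fin.card_Ici] at hcard
  have := (s j).2
  have := j.2
  omega

/-- A composition whose nonzero entries are weakly decreasing has a Demazure character given by a
flagged Jacobi–Trudi determinant. After reversal of the variables, the nonzero entries are
`w_0 ≤ w_1 ≤ ⋯`, at the positions `s_0 < s_1 < ⋯`. -/
theorem reverseVariables_demazureCharacter (γ : Fin n → ℕ) {s : Fin m → Fin n}
    (hs : StrictMono s) {w : Fin m → ℕ} (hw : Monotone w) (hpos : ∀ j, 0 < w j)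
    (hγ : ∀ j, γ (s j).rev = w j) (hγ0 : ∀ i, i ∉ Set.range s → γ i.rev = 0) :
    reverseVariables (demazureCharacter γ) = (flaggedMatrix (fun j => w j + j) s).det := by
  induction hN : ∑ l : Fin n, (l : ℕ) * γ l using Nat.strong_induction_on generalizing γ s with
  | _ N ih =>
  subst hN
  have hmem : ∀ i : Fin n, 0 < γ i.rev → i ∈ Set.range s := fun i hi =>
    by_contra fun h => hi.ne' (hγ0 i h)
  rw [demazureCharacter]
  split_ifs with h
  · set i := (ascents γ).min' h
    obtain ⟨hlt, hasc⟩ : ∃ hlt : (i : ℕ) + 1 < n, γ i < γ ⟨i + 1, hlt⟩ :=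
      exists_of_mem_ascents (Finset.min'_mem _ h)
    set j : Fin n := ⟨i + 1, hlt⟩ with hj
    change reverseVariables (demazureOp i j (demazureCharacter (γ ∘ Equiv.swap i j))) = _
    have hij : i < j := Fin.lt_def.2 (Nat.lt_succ_self _)
    -- The ascent has a zero at `i`, and its entry at `j` belongs to the row `a`; the recursion
    -- moves the flag of this row from `j.rev` to `i.rev`, which is not the flag of any row.
    obtain ⟨a, ha⟩ := hmem j.rev (by rw [Fin.rev_rev]; omega)
    have hv : ∀ b, s b ≠ i.rev := by
      intro b hb
      have hab : a ≤ b := by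
        rw [← hs.le_iff_le, ha, hb]
        exact Fin.rev_le_rev.2 hij.le
      have := hw hab
      rw [← hγ, ← hγ, ha, hb, Fin.rev_rev, Fin.rev_rev] at this
      omega
    have huv : (i.rev : ℕ) = j.rev + 1 := by
      rw [Fin.val_rev, Fin.val_rev, hj]
      have := j.2
      rw [hj] at this
      simp only at this ⊢
      omega
    have hs' : StrictMono (Function.update s a i.rev) := by
      intro x y hxy
      have hsxy := hs hxy
      have hvx := hv x
      have hvy := hv y
      rw [Fin.lt_def] at hsxy ⊢
      rw [ne_eq, Fin.ext_iff] at hvx hvy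
      rcases eq_or_ne x a with rfl | hx
      · rw [Function.update_self, Function.update_of_ne hxy.ne']
        rw [ha] at hsxy
        omega
      · rw [Function.update_of_ne hx]
        rcases eq_or_ne y a with rfl | hy
        · rw [Function.update_self]
          rw [ha] at hsxy
          omega
        · rwa [Function.update_of_ne hy]
    have hγi : γ i = 0 := by
      have := hγ0 i.rev fun ⟨b, hb⟩ => hv b hb
      rwa [Fin.rev_rev] at this
    have hrec := ih _ (sum_mul_comp_swap_lt γ i j hij hasc) (γ ∘ Equiv.swap i j) hs' ?_ ?_ rfl
    · have hop := reverseVariables_demazureOp i j (demazureCharacter (γ ∘ Equiv.swap i j))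
      rw [hrec, ← det_flaggedMatrix_update _ a huv ha hv] at hop
      refine mul_left_cancel₀ (sub_ne_zero.2 fun he => ?_) hop
      have := Fin.rev_injective (X_injective he)
      exact hij.ne this
    · intro b
      rcases eq_or_ne b a with rfl | hb
      · rw [Function.update_self, Fin.rev_rev, Function.comp_apply, Equiv.swap_apply_left, ← hγ,
          ha, Fin.rev_rev]
      · rw [Function.update_of_ne hb, Function.comp_apply, Equiv.swap_apply_of_ne_of_ne, hγ]
        · intro he
          exact hv b (by rw [← he, Fin.rev_rev])
        · intro he
          exact hb (hs.injective (by rw [ha, ← he, Fin.rev_rev]))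
    · intro x hx
      rw [Function.comp_apply]
      by_cases hxj : x.rev = j
      · rw [hxj, Equiv.swap_apply_right, hγi]
      · have hxi : x.rev ≠ i := by
          intro he
          exact hx ⟨a, by rw [Function.update_self, ← he, Fin.rev_rev]⟩
        rw [Equiv.swap_apply_of_ne_of_ne hxi hxj]
        refine hγ0 x fun ⟨b, hb⟩ => hx ⟨b, ?_⟩
        rw [Function.update_of_ne, hb]
        rintro rfl
        exact hxj (by rw [← hb, ha, Fin.rev_rev])
  · -- Without ascents all nonzero entries come first.
    have hfin := add_eq_of_range_succ_closed hs fun x hx hxs => by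
      obtain ⟨b, rfl⟩ := hxs
      refine hmem _ ?_
      by_contra h0
      refine h ⟨(⟨s b + 1, hx⟩ : Fin n).rev, Finset.mem_filter.2 ⟨Finset.mem_univ _, ?_, ?_⟩⟩
      · rw [Fin.val_rev]
        simp only
        omega
      · refine (Nat.le_zero.1 (not_lt.1 h0)).trans_lt ?_
        have : (⟨((⟨s b + 1, hx⟩ : Fin n).rev : ℕ) + 1, by
            rw [Fin.val_rev]; simp only; omega⟩ : Fin n) = (s b).rev := by
          ext
          simp only [Fin.val_rev]
          omega
        rw [this, hγ]
        exact hpos b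
    rw [det_flaggedMatrix_of_final hfin fun j => Nat.le_add_left _ _, reverseVariables, map_prod]
    simp only [map_pow, rename_X, Nat.add_sub_cancel]
    rw [← Equiv.prod_comp Fin.revPerm]
    simp only [Fin.revPerm_apply, Fin.rev_rev]
    rw [← Finset.prod_subset (Finset.subset_univ (Finset.univ.map ⟨s, hs.injective⟩)),
      Finset.prod_map]
    · exact Finset.prod_congr rfl fun b _ => by
        rw [Function.Embedding.coeFn_mk, hγ]
    · intro x _ hx
      rw [hγ0 x, pow_zero]
      rintro ⟨b, rfl⟩
      exact hx (Finset.mem_map_of_mem ⟨s, hs.injective⟩ (Finset.mem_univ b))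

theorem card_filter_lt_orderEmbOfFin (S : Finset (Fin n)) (h : S.card = m) (j : Fin m) :
    (S.filter (· < S.orderEmbOfFin h j)).card = j := by
  have : S.filter (· < S.orderEmbOfFin h j) =
      (Finset.Iio j).map (S.orderEmbOfFin h).toEmbedding := by
    ext x
    simp only [Finset.mem_filter, Finset.mem_map, Finset.mem_Iio]
    constructor
    · rintro ⟨hx, hlt⟩
      obtain ⟨l, rfl⟩ : x ∈ Set.range (S.orderEmbOfFin h) := by
        rw [Finset.range_orderEmbOfFin]; exact hx
      exact ⟨l, (S.orderEmbOfFin h).lt_iff_lt.1 hlt, rfl⟩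
    · rintro ⟨l, hl, rfl⟩
      exact ⟨Finset.orderEmbOfFin_mem S h l, (S.orderEmbOfFin h).lt_iff_lt.2 hl⟩
  rw [this, Finset.card_map, Fin.card_Iio]

theorem skipVector_orderEmbOfFin (S : Finset (Fin n)) (h : S.card = m) (j : Fin m) :
    skipVector S (S.orderEmbOfFin h j) = (S.orderEmbOfFin h j : ℕ) + 1 - j := by
  rw [skipVector, if_pos (Finset.orderEmbOfFin_mem S h j), card_filter_lt_orderEmbOfFin]

theorem le_val_of_strictMono {s : Fin m → Fin n} (hs : StrictMono s) (j : Fin m) :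
    (j : ℕ) ≤ s j := by
  obtain ⟨j, hj⟩ := j
  induction j with
  | zero => exact Nat.zero_le _
  | succ j ih =>
    have h1 := ih (by omega)
    have h2 : s ⟨j, by omega⟩ < s ⟨j + 1, hj⟩ := hs (Fin.mk_lt_mk.2 (Nat.lt_succ_self j))
    rw [Fin.lt_def] at h2
    simp only at h1 ⊢
    omega

/-- The Demazure character of a reversed skip vector is `det (h_{s_j + 1 - l}(x_{s_j}, …, x_n))`. -/
theorem reverseVariables_demazureCharacter_skipVector (S : Finset (Fin n)) (h : S.card = m) :
    reverseVariables (demazureCharacter (skipVector S ∘ Fin.rev)) =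
      (flaggedMatrix (fun j => (S.orderEmbOfFin h j : ℕ) + 1) (S.orderEmbOfFin h)).det := by
  have hle := le_val_of_strictMono (S.orderEmbOfFin h).strictMono
  rw [reverseVariables_demazureCharacter (s := S.orderEmbOfFin h)
    (w := fun j => (S.orderEmbOfFin h j : ℕ) + 1 - j) _ (S.orderEmbOfFin h).strictMono]
  · congr 2
    funext j
    have := hle j
    omega
  · intro a b hab
    have hsub : ∀ a b : ℕ, ∀ (ha : a < m) (hb : b < m), a ≤ b →
        (S.orderEmbOfFin h ⟨a, ha⟩ : ℕ) + b ≤ S.orderEmbOfFin h ⟨b, hb⟩ + a := by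
      intro a b ha hb hab
      induction b, hab using Nat.le_induction with
      | base => rfl
      | succ b hab ih =>
        have h1 := ih (by omega)
        have h2 : S.orderEmbOfFin h ⟨b, by omega⟩ < S.orderEmbOfFin h ⟨b + 1, hb⟩ :=
          (S.orderEmbOfFin h).strictMono (Fin.mk_lt_mk.2 (Nat.lt_succ_self b))
        rw [Fin.lt_def] at h2
        omega
    obtain ⟨a, ha⟩ := a
    obtain ⟨b, hb⟩ := b
    have h0 := hsub a b ha hb hab
    have h1 := hle ⟨a, ha⟩
    have h2 := hle ⟨b, hb⟩
    simp only at h1 h2 ⊢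
    omega
  · intro j
    have := hle j
    omega
  · intro j
    rw [Function.comp_apply, Fin.rev_rev, skipVector_orderEmbOfFin]
  · intro i hi
    rw [Function.comp_apply, Fin.rev_rev, skipVector, if_neg]
    rwa [Finset.range_orderEmbOfFin] at hi

end

/-! ### Membership in the ideal -/

section
variable {n k r : ℕ}

theorem hsymm_mem_mixedIdeal {d : ℕ} (h1 : k + 1 ≤ d) (h2 : d ≤ k + n) :
    hsymm (Fin n) ℚ d ∈ mixedIdeal n k r :=
  Ideal.subset_span (Or.inl ⟨d, ⟨h1, h2⟩, rfl⟩)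

theorem coeff_elemPolynomial_mem_mixedIdeal {d : ℕ} (h : n - r + 1 ≤ d) :
    (elemPolynomial (Finset.univ : Finset (Fin n))).coeff d ∈ mixedIdeal n k r := by
  by_cases hd : d ≤ n
  · rw [coeff_elemPolynomial_univ]
    exact Ideal.mul_mem_left _ _ (Ideal.subset_span (Or.inr ⟨d, ⟨h, hd⟩, rfl⟩))
  · rw [elemPolynomial, Polynomial.coeff_eq_zero_of_natDegree_lt]
    · exact Ideal.zero_mem _
    · refine (natDegree_prod_linFactor_le _ _).trans_lt ?_
      rw [Finset.card_univ, Fintype.card_fin]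
      omega

/-- `h_{k+i}(x_i, …, x_n)` is a coefficient of `∏_{j < i} (1 - x_j t)` times the generating series
of the `h_d` in all variables. -/
theorem tailHsymm_mem_mixedIdeal (i : Fin n) : tailHsymm i (k + (i + 1)) ∈ mixedIdeal n k r := by
  have hcompl : Finset.univ \ Finset.Iio i = Finset.Ici i := by
    ext j
    simp
  rw [tailHsymm_eq_coeff, ← hcompl, completeSeries,
    ← prod_linFactor_mul_prod_geomSeries_of_superset (Finset.subset_univ (Finset.Iio i)),
    PowerSeries.coeff_mul]
  refine Ideal.sum_mem _ fun ⟨a, b⟩ hab => ?_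
  rw [Finset.HasAntidiagonal.mem_antidiagonal] at hab
  simp only at hab ⊢
  by_cases ha : a ≤ i
  · refine Ideal.mul_mem_left _ _ ?_
    have := hsymm_mem_mixedIdeal (n := n) (k := k) (r := r) (d := b) (by omega) (by omega)
    rwa [hsymm_eq_coeff] at this
  · rw [Polynomial.coeff_coe, Polynomial.coeff_eq_zero_of_natDegree_lt, zero_mul]
    · exact Ideal.zero_mem _
    · refine (natDegree_prod_linFactor_le _ _).trans_lt ?_
      rw [Fin.card_Iio]
      omega

/-- A determinant lies in an ideal if the matrix maps a vector with an entry `1` into the ideal. -/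
theorem det_mem_of_mulVec_mem {R ι : Type*} [CommRing R] [Fintype ι] [DecidableEq ι]
    {I : Ideal R} {M : Matrix ι ι R} {v : ι → R} {a : ι} (ha : v a = 1)
    (h : ∀ j, M.mulVec v j ∈ I) : M.det ∈ I := by
  have h1 : M.det = (M.adjugate.mulVec (M.mulVec v)) a := by
    rw [Matrix.mulVec_mulVec, Matrix.adjugate_mul, Matrix.smul_mulVec, Matrix.one_mulVec,
      Pi.smul_apply, ha, smul_eq_mul, mul_one]
  rw [h1]
  exact Ideal.sum_mem _ fun j _ => I.mul_mem_left _ (h j)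

/-- Combining the columns of the flagged matrix with the coefficients of `∏_i (1 - x_i t)` gives,
up to terms divisible by some `e_a` with `a > n - r`, coefficients of `∏_{i < s_j} (1 - x_i t)` in
degrees exceeding the degree of that polynomial. -/
theorem det_flaggedMatrix_mem_mixedIdeal {c : Fin (n - r + 1) → ℕ} {s : Fin (n - r + 1) → Fin n}
    (hc : ∀ j, (s j : ℕ) < c j) : (flaggedMatrix c s).det ∈ mixedIdeal n k r := by
  set E := elemPolynomial (Finset.univ : Finset (Fin n)) with hE
  refine det_mem_of_mulVec_mem (v := fun l => E.coeff l) (a := 0) ?_ fun j => ?_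
  · simp [hE, coeff_elemPolynomial_univ]
  set f : ℕ → MvPolynomial (Fin n) ℚ := fun l =>
    PowerSeries.coeff (c j) (PowerSeries.X ^ l * completeSeries (Finset.Ici (s j))) * E.coeff l
  have hf : (flaggedMatrix c s).mulVec (fun l => E.coeff l) j =
      ∑ l ∈ Finset.range (n - r + 1), f l := by
    rw [← Fin.sum_univ_eq_sum_range]
    rfl
  have hdeg : E.natDegree < n - r + 1 + n := by
    refine (natDegree_prod_linFactor_le _ _).trans_lt ?_
    rw [Finset.card_univ, Fintype.card_fin]
    omega
  have hzero : ∑ l ∈ Finset.range (n - r + 1 + n), f l = 0 := by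
    rw [sum_coeff_X_pow_mul _ _ hdeg, hE, elemPolynomial, completeSeries,
      prod_linFactor_mul_prod_geomSeries_of_subset (Finset.subset_univ _), Polynomial.coeff_coe,
      Polynomial.coeff_eq_zero_of_natDegree_lt]
    refine (natDegree_prod_linFactor_le _ _).trans_lt ?_
    rw [Finset.card_sdiff_of_subset (Finset.subset_univ _), Finset.card_univ, Fintype.card_fin,
      Fin.card_Ici]
    have := hc j
    have := (s j).2
    omega
  rw [Finset.sum_range_add] at hzero
  rw [hf, eq_neg_of_add_eq_zero_left hzero]
  exact neg_mem (Ideal.sum_mem _ fun l _ =>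
    Ideal.mul_mem_left _ _ (coeff_elemPolynomial_mem_mixedIdeal (Nat.le_add_right _ _)))

theorem mixedGroebnerFamily_mem (a : Fin n ⊕ {S : Finset (Fin n) // S.card = n - r + 1}) :
    mixedGroebnerFamily n k r a ∈ mixedIdeal n k r := by
  rcases a with i | ⟨S, hS⟩
  · exact tailHsymm_mem_mixedIdeal i
  · change reverseVariables (demazureCharacter (skipVector S ∘ Fin.rev)) ∈ _
    rw [reverseVariables_demazureCharacter_skipVector S hS]
    exact det_flaggedMatrix_mem_mixedIdeal fun j => Nat.lt_succ_self _

end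

/-! ### Leading terms -/

section
variable {n m : ℕ}

theorem lex_lt_of_apply_lt {u v : Fin n →₀ ℕ} (i : Fin n) (h : ∀ j < i, u j = v j)
    (hi : u i < v i) :
    MonomialOrder.lex.toSyn u < MonomialOrder.lex.toSyn v :=
  MonomialOrder.lex_lt_iff.2 (Finsupp.Lex.lt_iff.2 ⟨i, h, hi⟩)

theorem coeff_coeff_completeSeries (T : Finset (Fin n)) (d : ℕ) (u : Fin n →₀ ℕ) :
    MvPolynomial.coeff u (PowerSeries.coeff d (completeSeries T)) =
      if u ∈ T.finsuppAntidiag d then 1 else 0 := by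
  rw [coeff_completeSeries, MvPolynomial.coeff_sum]
  simp only [coeff_monomial]
  rw [Finset.sum_ite_eq']

theorem single_mem_finsuppAntidiag (i : Fin n) (d : ℕ) :
    Finsupp.single i d ∈ (Finset.Ici i).finsuppAntidiag d := by
  rw [Finset.mem_finsuppAntidiag]
  refine ⟨?_, fun j hj => ?_⟩
  · rw [Finset.sum_eq_single i]
    · simp
    · intro j _ hj
      rw [Finsupp.single_apply, if_neg hj.symm]
    · intro h
      exact absurd (Finset.mem_Ici.2 le_rfl) h
  · have := Finsupp.support_single_subset hj
    rw [Finset.mem_singleton] at this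
    rw [this, Finset.mem_Ici]

theorem degree_coeff_completeSeries_Ici (i : Fin n) (d : ℕ) :
    MonomialOrder.lex.degree (PowerSeries.coeff d (completeSeries (Finset.Ici i))) =
      Finsupp.single i d := by
  refine MonomialOrder.lex.toSyn.injective (le_antisymm ?_ ?_)
  · rw [MonomialOrder.degree_le_iff]
    intro u hu
    rw [mem_support_iff, coeff_coeff_completeSeries] at hu
    have hu : u ∈ (Finset.Ici i).finsuppAntidiag d := by_contra fun h => hu (if_neg h)
    rw [Finset.mem_finsuppAntidiag] at hu
    have hsplit : u i + ∑ j ∈ (Finset.Ici i).erase i, u j = d := by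
      rw [Finset.add_sum_erase _ _ (Finset.mem_Ici.2 le_rfl), hu.1]
    have hlow : ∀ j < i, u j = 0 := fun j hj => Finsupp.notMem_support_iff.1 fun h =>
      (Finset.mem_Ici.1 (hu.2 h)).not_gt hj
    by_cases hi : u i = d
    · have : u = Finsupp.single i d := by
        ext j
        rcases lt_trichotomy j i with hj | rfl | hj
        · rw [hlow j hj, Finsupp.single_apply, if_neg hj.ne']
        · rw [hi, Finsupp.single_eq_same]
        · rw [Finsupp.single_apply, if_neg hj.ne]
          have h0 : ∑ j ∈ (Finset.Ici i).erase i, u j = 0 := by omega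
          exact Finset.sum_eq_zero_iff.1 h0 j
            (Finset.mem_erase.2 ⟨hj.ne', Finset.mem_Ici.2 hj.le⟩)
      rw [this]
    · refine (lex_lt_of_apply_lt i (fun j hj => ?_) ?_).le
      · rw [hlow j hj, Finsupp.single_apply, if_neg hj.ne']
      · rw [Finsupp.single_eq_same]
        omega
  · refine MonomialOrder.le_degree ?_
    rw [mem_support_iff, coeff_coeff_completeSeries, if_pos (single_mem_finsuppAntidiag i d)]
    exact one_ne_zero

theorem monic_coeff_completeSeries_Ici (i : Fin n) (d : ℕ) :
    MonomialOrder.lex.Monic (PowerSeries.coeff d (completeSeries (Finset.Ici i))) := by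
  rw [MonomialOrder.Monic, MonomialOrder.leadingCoeff, degree_coeff_completeSeries_Ici,
    coeff_coeff_completeSeries, if_pos (single_mem_finsuppAntidiag i d)]

theorem degree_flaggedMatrix_le (c : Fin m → ℕ) (s : Fin m → Fin n) (j l : Fin m) :
    MonomialOrder.lex.toSyn (MonomialOrder.lex.degree (flaggedMatrix c s j l)) ≤
      MonomialOrder.lex.toSyn (Finsupp.single (s j) (c j - l)) := by
  rw [flaggedMatrix_apply, PowerSeries.coeff_X_pow_mul']
  split_ifs
  · rw [degree_coeff_completeSeries_Ici]
  · rw [MonomialOrder.degree_zero, map_zero]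
    exact MonomialOrder.zero_le _ _

theorem sum_single_apply {s : Fin m → Fin n} (hs : Function.Injective s) (e : Fin m → ℕ)
    (j : Fin m) : (∑ i, Finsupp.single (s i) (e i)) (s j) = e j := by
  rw [Finsupp.finsetSum_apply, Finset.sum_eq_single j]
  · rw [Finsupp.single_eq_same]
  · intro i _ hi
    rw [Finsupp.single_apply, if_neg fun h => hi (hs h)]
  · exact fun h => absurd (Finset.mem_univ _) h

theorem sum_single_apply_of_notMem_range {s : Fin m → Fin n} (e : Fin m → ℕ)
    {x : Fin n} (hx : x ∉ Set.range s) : (∑ i, Finsupp.single (s i) (e i)) x = 0 := by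
  rw [Finsupp.finsetSum_apply]
  exact Finset.sum_eq_zero fun i _ => by
    rw [Finsupp.single_apply, if_neg fun h => hx ⟨i, h⟩]

/-- A nontrivial permutation lowers the exponent sequence in the lexicographic order: at the first
index it moves, it takes a larger value. -/
theorem lex_sum_single_perm_lt {c : Fin m → ℕ} {s : Fin m → Fin n} (hs : StrictMono s)
    (hc : ∀ j : Fin m, (j : ℕ) < c j) {σ : Equiv.Perm (Fin m)} (hσ : σ ≠ 1) :
    MonomialOrder.lex.toSyn (∑ j, Finsupp.single (s j) (c j - σ j)) <
      MonomialOrder.lex.toSyn (∑ j, Finsupp.single (s j) (c j - j)) := by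
  have hne : (Finset.univ.filter fun j => σ j ≠ j).Nonempty := by
    by_contra h
    rw [Finset.not_nonempty_iff_eq_empty, Finset.filter_eq_empty_iff] at h
    exact hσ (Equiv.ext fun j => not_not.1 (h (Finset.mem_univ j)))
  set i := (Finset.univ.filter fun j => σ j ≠ j).min' hne
  have hi : σ i ≠ i := (Finset.mem_filter.1 (Finset.min'_mem _ hne)).2
  have hfix : ∀ j < i, σ j = j := by
    intro j hj
    by_contra h
    exact hj.not_ge (Finset.min'_le _ j (Finset.mem_filter.2 ⟨Finset.mem_univ j, h⟩))
  have hlt : i < σ i := by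
    refine lt_of_le_of_ne (not_lt.1 fun h => ?_) hi.symm
    exact hi (σ.injective (hfix _ h))
  refine lex_lt_of_apply_lt (s i) (fun x hx => ?_) ?_
  · by_cases hxs : x ∈ Set.range s
    · obtain ⟨j, rfl⟩ := hxs
      rw [sum_single_apply hs.injective (fun j => c j - σ j),
        sum_single_apply hs.injective (fun j => c j - j), hfix j (hs.lt_iff_lt.1 hx)]
    · rw [sum_single_apply_of_notMem_range (fun j => c j - σ j) hxs,
        sum_single_apply_of_notMem_range (fun j => c j - j) hxs]
  · rw [sum_single_apply hs.injective (fun j => c j - σ j),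
      sum_single_apply hs.injective (fun j => c j - j)]
    have := hc i
    have : (i : ℕ) < σ i := hlt
    omega

theorem degree_sign_smul (σ : Equiv.Perm (Fin m)) (p : MvPolynomial (Fin n) ℚ) :
    MonomialOrder.lex.degree (Equiv.Perm.sign σ • p) = MonomialOrder.lex.degree p := by
  rcases Int.units_eq_one_or (Equiv.Perm.sign σ) with h | h
  · rw [h, one_smul]
  · rw [h, Units.neg_smul, one_smul, MonomialOrder.degree_neg]

theorem degree_prod_flaggedMatrix_le (c : Fin m → ℕ) (s : Fin m → Fin n)
    (σ : Equiv.Perm (Fin m)) :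
    MonomialOrder.lex.toSyn (MonomialOrder.lex.degree (∏ j, flaggedMatrix c s j (σ j))) ≤
      MonomialOrder.lex.toSyn (∑ j, Finsupp.single (s j) (c j - σ j)) := by
  refine MonomialOrder.degree_prod_le.trans ?_
  rw [map_sum, map_sum]
  exact Finset.sum_le_sum fun j _ => degree_flaggedMatrix_le c s j (σ j)

theorem sum_single_ne_zero {c : Fin m → ℕ} {s : Fin m → Fin n} (hs : StrictMono s)
    (hc : ∀ j : Fin m, (j : ℕ) < c j) (hm : 0 < m) :
    ∑ j, Finsupp.single (s j) (c j - j) ≠ 0 := by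
  intro h0
  have h1 := sum_single_apply hs.injective (fun j => c j - j) ⟨0, hm⟩
  rw [h0, Finsupp.coe_zero, Pi.zero_apply] at h1
  exact absurd (hc ⟨0, hm⟩) (not_lt.2 (Nat.sub_eq_zero_iff_le.1 h1.symm))

theorem det_eq_prod_diag_add {R : Type*} [CommRing R] (A : Matrix (Fin m) (Fin m) R) :
    A.det = ∏ j, A j j +
      ∑ σ ∈ (Finset.univ : Finset (Equiv.Perm (Fin m))).erase 1,
        Equiv.Perm.sign σ • ∏ j, A j (σ j) := by
  have h := Finset.add_sum_erase (Finset.univ : Finset (Equiv.Perm (Fin m)))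
    (fun σ => Equiv.Perm.sign σ • ∏ j, A j (σ j)) (Finset.mem_univ 1)
  rw [Equiv.Perm.sign_one, one_smul] at h
  rw [← Matrix.det_transpose, Matrix.det_apply]
  exact h.symm

/-- The leading term of a flagged determinant is the product of the leading terms on the
diagonal. -/
theorem monic_det_flaggedMatrix {c : Fin m → ℕ} {s : Fin m → Fin n} (hs : StrictMono s)
    (hc : ∀ j : Fin m, (j : ℕ) < c j) (hm : 0 < m) :
    MonomialOrder.lex.Monic (flaggedMatrix c s).det ∧
      MonomialOrder.lex.degree (flaggedMatrix c s).det =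
        ∑ j, Finsupp.single (s j) (c j - j) := by
  have hdiag : ∀ j, MonomialOrder.lex.Monic (flaggedMatrix c s j j) ∧
      MonomialOrder.lex.degree (flaggedMatrix c s j j) = Finsupp.single (s j) (c j - j) := by
    intro j
    rw [flaggedMatrix_apply, PowerSeries.coeff_X_pow_mul', if_pos (hc j).le]
    exact ⟨monic_coeff_completeSeries_Ici _ _, degree_coeff_completeSeries_Ici _ _⟩
  have hD : MonomialOrder.lex.Monic (∏ j, flaggedMatrix c s j j) :=
    MonomialOrder.Monic.prod fun j _ => (hdiag j).1
  have hDdeg : MonomialOrder.lex.degree (∏ j, flaggedMatrix c s j j) =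
      ∑ j, Finsupp.single (s j) (c j - j) := by
    rw [MonomialOrder.degree_prod fun j _ => (hdiag j).1.ne_zero]
    exact Finset.sum_congr rfl fun j _ => (hdiag j).2
  set rest := ∑ σ ∈ (Finset.univ : Finset (Equiv.Perm (Fin m))).erase 1,
    Equiv.Perm.sign σ • ∏ j, flaggedMatrix c s j (σ j) with hrest
  have hlt : MonomialOrder.lex.toSyn (MonomialOrder.lex.degree rest) <
      MonomialOrder.lex.toSyn (MonomialOrder.lex.degree (∏ j, flaggedMatrix c s j j)) := by
    rw [hDdeg]
    refine MonomialOrder.degree_sum_le.trans_lt ((Finset.sup_lt_iff ?_).2 fun σ hσ => ?_)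
    · rw [MonomialOrder.bot_eq_zero, MonomialOrder.toSyn_lt_iff_ne_zero]
      exact fun h => sum_single_ne_zero hs hc hm ((MonomialOrder.toSyn_eq_zero_iff _ _).1 h)
    · rw [degree_sign_smul]
      exact (degree_prod_flaggedMatrix_le c s σ).trans_lt
        (lex_sum_single_perm_lt hs hc (Finset.ne_of_mem_erase hσ))
  rw [det_eq_prod_diag_add, ← hrest]
  exact ⟨hD.add_of_lt hlt, (MonomialOrder.degree_add_of_lt hlt).trans hDdeg⟩

theorem monic_mixedGroebnerFamily {n k r : ℕ}
    (a : Fin n ⊕ {S : Finset (Fin n) // S.card = n - r + 1}) :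
    MonomialOrder.lex.Monic (mixedGroebnerFamily n k r a) := by
  rcases a with i | ⟨S, hS⟩
  · change MonomialOrder.lex.Monic (tailHsymm i (k + (i + 1)))
    rw [tailHsymm_eq_coeff]
    exact monic_coeff_completeSeries_Ici _ _
  · change MonomialOrder.lex.Monic (reverseVariables (demazureCharacter (skipVector S ∘ Fin.rev)))
    rw [reverseVariables_demazureCharacter_skipVector S hS]
    exact (monic_det_flaggedMatrix (S.orderEmbOfFin hS).strictMono (fun j => Nat.lt_succ_of_le
      (le_val_of_strictMono (S.orderEmbOfFin hS).strictMono j)) (Nat.succ_pos _)).1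

theorem degree_mixedGroebnerFamily_inl {n k r : ℕ} (i : Fin n) :
    MonomialOrder.lex.degree (mixedGroebnerFamily n k r (.inl i)) =
      Finsupp.single i (k + (i + 1)) := by
  change MonomialOrder.lex.degree (tailHsymm i (k + (i + 1))) = _
  rw [tailHsymm_eq_coeff, degree_coeff_completeSeries_Ici]

theorem degree_mixedGroebnerFamily_inr {n k r : ℕ}
    (S : {S : Finset (Fin n) // S.card = n - r + 1}) (x : Fin n) :
    MonomialOrder.lex.degree (mixedGroebnerFamily n k r (.inr S)) x = skipVector S.1 x := by
  obtain ⟨S, hS⟩ := S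
  change MonomialOrder.lex.degree
    (reverseVariables (demazureCharacter (skipVector S ∘ Fin.rev))) x = skipVector S x
  rw [reverseVariables_demazureCharacter_skipVector S hS,
    (monic_det_flaggedMatrix (S.orderEmbOfFin hS).strictMono (fun j => Nat.lt_succ_of_le
      (le_val_of_strictMono (S.orderEmbOfFin hS).strictMono j)) (Nat.succ_pos _)).2]
  by_cases hx : x ∈ Set.range (S.orderEmbOfFin hS)
  · obtain ⟨j, rfl⟩ := hx
    rw [sum_single_apply (S.orderEmbOfFin hS).injective
      (fun j => (S.orderEmbOfFin hS j : ℕ) + 1 - j), skipVector_orderEmbOfFin]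
  · rw [sum_single_apply_of_notMem_range (fun j => (S.orderEmbOfFin hS j : ℕ) + 1 - j) hx,
      skipVector, if_neg]
    rwa [Finset.range_orderEmbOfFin] at hx

end

/-! ### Vanishing on points with distinct coordinates -/

section
variable {n : ℕ}

theorem isHomogeneous_hsymm (d : ℕ) : (hsymm (Fin n) ℚ d).IsHomogeneous d := by
  rw [hsymm_eq_coeff, coeff_completeSeries]
  refine IsHomogeneous.sum _ _ _ fun u hu => isHomogeneous_monomial _ ?_
  rw [Finsupp.degree_eq_sum]
  exact (Finset.mem_finsuppAntidiag.1 hu).1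

theorem isHomogeneous_esymm (d : ℕ) : (esymm (Fin n) ℚ d).IsHomogeneous d := by
  rw [esymm]
  refine IsHomogeneous.sum _ _ _ fun t ht => ?_
  have h := IsHomogeneous.prod t (fun i => (X i : MvPolynomial (Fin n) ℚ)) (fun _ => 1)
    fun i _ => isHomogeneous_X ℚ i
  rwa [Finset.sum_const, smul_eq_mul, mul_one, (Finset.mem_powersetCard.1 ht).2] at h

/-- If a combination `∑ c_a F_{d-a}` of homogeneous polynomials `F_b` of degree `b`, with `c_0 = 1`,
vanishes on a set of points, then `F_d` agrees there with a polynomial of smaller degree. -/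
theorem exists_lower_of_sum_antidiagonal {ι : Type*} (pt : ι → Fin n → ℚ)
    {F : ℕ → MvPolynomial (Fin n) ℚ} (hF : ∀ b, (F b).IsHomogeneous b) {c : ℕ → ℚ} (hc : c 0 = 1)
    {d : ℕ} (h : ∀ y, ∑ p ∈ Finset.HasAntidiagonal.antidiagonal d,
      c p.1 * eval (pt y) (F p.2) = 0) :
    ∃ q ∈ ⨆ e ∈ Set.Iio d, homogeneousSubmodule (Fin n) ℚ e, evalAt pt (F d - q) = 0 := by
  refine ⟨F d - ∑ p ∈ Finset.HasAntidiagonal.antidiagonal d, c p.1 • F p.2, ?_, ?_⟩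
  · have h0 : (0, d) ∈ Finset.HasAntidiagonal.antidiagonal d :=
      Finset.HasAntidiagonal.mem_antidiagonal.2 (zero_add d)
    rw [← Finset.add_sum_erase _ _ h0, hc, one_smul, sub_add_cancel_left]
    refine Submodule.neg_mem _ (Submodule.sum_mem _ fun p hp => Submodule.smul_mem _ _ ?_)
    obtain ⟨a, b⟩ := p
    rw [Finset.mem_erase, Finset.HasAntidiagonal.mem_antidiagonal] at hp
    obtain ⟨hne, hab⟩ := hp
    simp only at hab ⊢
    have hb : b < d := by
      rcases Nat.eq_zero_or_pos a with rfl | ha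
      · rw [zero_add] at hab
        exact absurd (by rw [hab]) hne
      · omega
    exact Submodule.mem_iSup_of_mem b (Submodule.mem_iSup_of_mem hb (hF b))
  · rw [sub_sub_cancel]
    funext y
    rw [evalAt_apply, map_sum]
    simp only [smul_eval]
    exact h y

variable {k r : ℕ}

/-- The injections `{0, …, n - 1} → {0, …, n + k - 1}` whose range contains `0, …, r - 1`. They are
read as points of `ℚ ^ n`; `mixedIdeal` is generated by top degree forms of polynomials vanishing at
these points. -/
abbrev RestrictedInjection (n k r : ℕ) : Type :=
  {f : Fin n ↪ Fin (n + k) // ∀ j : Fin (n + k), (j : ℕ) < r → ∃ i, f i = j}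

/-- The point of `ℚ ^ n` given by an injection. -/
def injectionPoint (f : RestrictedInjection n k r) (i : Fin n) : ℚ := ((f.1 i : ℕ) : ℚ)

theorem injectionPoint_injective :
    Function.Injective (injectionPoint : RestrictedInjection n k r → Fin n → ℚ) := by
  intro f g h
  refine Subtype.ext (Function.Embedding.ext fun i => Fin.ext ?_)
  exact Nat.cast_injective (congrFun h i)

theorem prod_injectionPoint {A : Type*} [CommMonoid A] (f : RestrictedInjection n k r)
    (F : ℚ → A) :
    ∏ i, F (injectionPoint f i) = ∏ j ∈ Finset.univ.map f.1, F ((j : ℕ) : ℚ) := by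
  rw [Finset.prod_map]
  rfl

theorem map_eval_completeSeries (y : Fin n → ℚ) :
    PowerSeries.map (eval y) (completeSeries Finset.univ) = ∏ i, geomSeries (y i) := by
  rw [completeSeries, map_prod]
  exact Finset.prod_congr rfl fun i _ => by rw [map_geomSeries, eval_X]

theorem eval_hsymm (y : Fin n → ℚ) (d : ℕ) :
    eval y (hsymm (Fin n) ℚ d) = PowerSeries.coeff d (∏ i, geomSeries (y i)) := by
  rw [hsymm_eq_coeff, ← map_eval_completeSeries, PowerSeries.coeff_map]

theorem eval_esymm (y : Fin n → ℚ) (d : ℕ) :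
    eval y (esymm (Fin n) ℚ d) = (-1) ^ d * (∏ i, linFactor (y i)).coeff d := by
  rw [coeff_prod_linFactor, ← mul_assoc, ← mul_pow, neg_one_mul, neg_neg, one_pow, one_mul, esymm,
    map_sum]
  simp

/-- On the points, `∏_j (1 - j t) / ∏_i (1 - x_i t)` is a polynomial of degree `k`, where `j` runs
through all possible coordinates. -/
theorem exists_lower_hsymm {d : ℕ} (hd : k < d) :
    ∃ q ∈ ⨆ e ∈ Set.Iio d, homogeneousSubmodule (Fin n) ℚ e,
      evalAt (injectionPoint : RestrictedInjection n k r → Fin n → ℚ)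
        (hsymm (Fin n) ℚ d - q) = 0 := by
  set P : Polynomial ℚ := ∏ j : Fin (n + k), linFactor (((j : ℕ) : ℚ)) with hP
  refine exists_lower_of_sum_antidiagonal _ isHomogeneous_hsymm (c := P.coeff) ?_ fun f => ?_
  · rw [hP, coeff_prod_linFactor]
    simp
  · simp only [eval_hsymm, ← Polynomial.coeff_coe P]
    rw [← PowerSeries.coeff_mul, prod_injectionPoint f geomSeries, hP,
      prod_linFactor_mul_prod_geomSeries_of_subset (Finset.subset_univ _)
        (fun j : Fin (n + k) => ((j : ℕ) : ℚ)), Polynomial.coeff_coe,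
      Polynomial.coeff_eq_zero_of_natDegree_lt]
    refine (natDegree_prod_linFactor_le _ _).trans_lt ?_
    rw [Finset.card_sdiff_of_subset (Finset.subset_univ _), Finset.card_map, Finset.card_univ,
      Finset.card_univ, Fintype.card_fin, Fintype.card_fin]
    omega

/-- On the points, `∏_i (1 - x_i t) / ∏_{j < r} (1 - j t)` is a polynomial of degree `n - r`. -/
theorem exists_lower_esymm (hr : r ≤ n) {d : ℕ} (hd : n - r < d) :
    ∃ q ∈ ⨆ e ∈ Set.Iio d, homogeneousSubmodule (Fin n) ℚ e,
      evalAt (injectionPoint : RestrictedInjection n k r → Fin n → ℚ)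
        (esymm (Fin n) ℚ d - q) = 0 := by
  set R : Finset (Fin (n + k)) := Finset.univ.filter fun j => (j : ℕ) < r with hR
  have hRcard : R.card = r := by
    rw [hR, Fin.card_filter_val_lt, min_eq_right (by omega)]
  set H : PowerSeries ℚ := ∏ j ∈ R, geomSeries (((j : ℕ) : ℚ)) with hH
  refine exists_lower_of_sum_antidiagonal _ isHomogeneous_esymm
    (c := fun a => (-1) ^ a * PowerSeries.coeff a H) ?_ fun f => ?_
  · rw [pow_zero, one_mul, PowerSeries.coeff_zero_eq_constantCoeff, hH, map_prod]
    refine Finset.prod_eq_one fun j _ => ?_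
    rw [← PowerSeries.coeff_zero_eq_constantCoeff, geomSeries, PowerSeries.coeff_mk, pow_zero]
  · have hsub : R ⊆ Finset.univ.map f.1 := by
      intro j hj
      obtain ⟨i, hi⟩ := f.2 j (Finset.mem_filter.1 hj).2
      exact Finset.mem_map.2 ⟨i, Finset.mem_univ i, hi⟩
    have hterm : ∀ p ∈ Finset.HasAntidiagonal.antidiagonal d,
        (-1) ^ p.1 * PowerSeries.coeff p.1 H *
          eval (injectionPoint f) (esymm (Fin n) ℚ p.2) =
        (-1) ^ d * (PowerSeries.coeff p.1 H * PowerSeries.coeff p.2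
          ((∏ i, linFactor (injectionPoint f i) : Polynomial ℚ) : PowerSeries ℚ)) := by
      intro p hp
      rw [eval_esymm, Polynomial.coeff_coe, ← Finset.HasAntidiagonal.mem_antidiagonal.1 hp, pow_add]
      ring
    rw [Finset.sum_congr rfl hterm, ← Finset.mul_sum, ← PowerSeries.coeff_mul, mul_comm H,
      prod_injectionPoint f linFactor, hH, prod_linFactor_mul_prod_geomSeries_of_subset hsub
        (fun j : Fin (n + k) => ((j : ℕ) : ℚ)), Polynomial.coeff_coe,
      Polynomial.coeff_eq_zero_of_natDegree_lt, mul_zero]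
    refine (natDegree_prod_linFactor_le _ _).trans_lt ?_
    rw [Finset.card_sdiff_of_subset hsub, Finset.card_map, Finset.card_univ, Fintype.card_fin,
      hRcard]
    exact hd

theorem le_card_restrictedInjection (hr : r ≤ n) :
    n.factorial * (n - r + k).choose (n - r) ≤ Fintype.card (RestrictedInjection n k r) := by
  set R : Finset (Fin (n + k)) := Finset.univ.filter fun j => (j : ℕ) < r with hR
  have hRcard : R.card = r := by
    rw [hR, Fin.card_filter_val_lt, min_eq_right (by omega)]
  have hT : ∀ U ∈ Rᶜ.powersetCard (n - r), (R ∪ U).card = n := by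
    intro U hU
    rw [Finset.mem_powersetCard] at hU
    rw [Finset.card_union_of_disjoint (Finset.disjoint_left.2 fun x hx hxU =>
      Finset.mem_compl.1 (hU.1 hxU) hx), hRcard, hU.2]
    omega
  let Φ : Equiv.Perm (Fin n) × {U // U ∈ Rᶜ.powersetCard (n - r)} → RestrictedInjection n k r :=
    fun p => ⟨p.1.toEmbedding.trans ((R ∪ p.2.1).orderEmbOfFin (hT _ p.2.2)).toEmbedding,
      fun j hj => by
        have hj' : j ∈ Set.range ((R ∪ p.2.1).orderEmbOfFin (hT _ p.2.2)) := by
          rw [Finset.range_orderEmbOfFin]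
          exact Finset.mem_union_left _ (Finset.mem_filter.2 ⟨Finset.mem_univ j, hj⟩)
        obtain ⟨i, hi⟩ := hj'
        exact ⟨p.1.symm i, by simpa using hi⟩⟩
  have hrange : ∀ p, Set.range (Φ p).1 = (R ∪ p.2.1 : Finset _) := by
    intro p
    rw [← Finset.range_orderEmbOfFin (R ∪ p.2.1) (hT _ p.2.2)]
    exact p.1.surjective.range_comp ((R ∪ p.2.1).orderEmbOfFin (hT _ p.2.2))
  have hΦ : Function.Injective Φ := by
    rintro ⟨σ, U, hU⟩ ⟨τ, V, hV⟩ h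
    have hUV : R ∪ U = R ∪ V := by
      have := hrange (σ, ⟨U, hU⟩)
      rw [h, hrange] at this
      exact (Finset.coe_injective this).symm
    have hdisj : ∀ W ∈ Rᶜ.powersetCard (n - r), (R ∪ W) \ R = W := fun W hW =>
      Finset.union_sdiff_cancel_left (Finset.disjoint_left.2 fun x hx hxW =>
        Finset.mem_compl.1 ((Finset.mem_powersetCard.1 hW).1 hxW) hx)
    obtain rfl : U = V := by rw [← hdisj U hU, hUV, hdisj V hV]
    have hστ : σ = τ := by
      ext i : 1
      have := congrArg (fun f : RestrictedInjection n k r => f.1 i) h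
      exact ((R ∪ U).orderEmbOfFin (hT _ hU)).injective this
    rw [hστ]
  have hle := Fintype.card_le_of_injective Φ hΦ
  rw [Fintype.card_prod, Fintype.card_perm, Fintype.card_fin, Fintype.card_coe,
    Finset.card_powersetCard, Finset.card_compl, hRcard, Fintype.card_fin] at hle
  rwa [show n - r + k = n + k - r by omega]

end

/-! ### Counting nonskip exponents -/

section

/-- The number of positions among the first `i` that the greedy search for a set `S` with
`skipVector S ≤ a` selects: position `i` is selected if `a i` is at least `i + 1` minus the number
of positions already selected. -/
def greedySkips (a : ℕ → ℕ) : ℕ → ℕ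
  | 0 => 0
  | i + 1 => greedySkips a i + if i + 1 - greedySkips a i ≤ a i then 1 else 0

/-- The first `p` positions selected by the greedy search, among those less than `j`. -/
theorem card_filter_greedySkips (a : ℕ → ℕ) (p j : ℕ) :
    ((Finset.range j).filter fun i => i + 1 - greedySkips a i ≤ a i ∧ greedySkips a i < p).card =
      min (greedySkips a j) p := by
  induction j with
  | zero => simp [greedySkips]
  | succ j ih =>
    rw [Finset.range_add_one, Finset.filter_insert, greedySkips]
    split_ifs with h1 h2 h2
    · rw [Finset.card_insert_of_notMem (by simp), ih]
      omega
    · exact absurd h1.1 h2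
    · rw [ih]
      have : ¬ greedySkips a j < p := fun h => h1 ⟨h2, h⟩
      omega
    · rw [ih, add_zero]

theorem card_filter_fin {n : ℕ} (P : ℕ → Prop) [DecidablePred P] {j : ℕ} (hj : j ≤ n) :
    (Finset.univ.filter fun x : Fin n => P x ∧ (x : ℕ) < j).card =
      ((Finset.range j).filter P).card := by
  rw [← Finset.card_map Fin.valEmbedding]
  congr 1
  ext x
  simp only [Finset.mem_map, Finset.mem_filter, Finset.mem_univ, true_and, Fin.valEmbedding_apply,
    Finset.mem_range]
  constructor
  · rintro ⟨y, ⟨h1, h2⟩, rfl⟩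
    exact ⟨h2, h1⟩
  · rintro ⟨h1, h2⟩
    exact ⟨⟨x, by omega⟩, ⟨h2, h1⟩, rfl⟩

/-- If the greedy search selects at least `p` positions, then the first `p` of them form a set whose
skip vector lies below `a`. -/
theorem exists_skipVector_le {n p : ℕ} {a : ℕ → ℕ} (h : p ≤ greedySkips a n) :
    ∃ S : Finset (Fin n), S.card = p ∧ ∀ i, skipVector S i ≤ a i := by
  let P : ℕ → Prop := fun i => i + 1 - greedySkips a i ≤ a i ∧ greedySkips a i < p
  refine ⟨Finset.univ.filter fun x : Fin n => P x, ?_, fun i => ?_⟩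
  · have h1 := card_filter_fin P (le_refl n)
    simp only [Fin.is_lt, and_true] at h1
    rw [h1, card_filter_greedySkips, min_eq_right h]
  · rw [skipVector]
    split_ifs with hi
    · have hPi : P i := (Finset.mem_filter.1 hi).2
      rw [Finset.filter_filter]
      have h1 := card_filter_fin P i.2.le
      rw [card_filter_greedySkips, min_eq_left hPi.2.le] at h1
      simp only [Fin.lt_def]
      rw [h1]
      exact hPi.1
    · exact Nat.zero_le _

open Classical in
/-- The sequences `a` supported on `{0, …, n - 1}` with `a i ≤ k + i` for which the greedy search
selects `c` positions. -/
noncomputable def nonskipSequences (k : ℕ) : ℕ → ℕ → Finset (ℕ → ℕ)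
  | 0, 0 => {0}
  | 0, _ + 1 => ∅
  | n + 1, 0 =>
    (nonskipSequences k n 0 ×ˢ Finset.range (n + 1)).image fun p => Function.update p.1 n p.2
  | n + 1, c + 1 =>
    ((nonskipSequences k n (c + 1) ×ˢ Finset.range (n - c)).image
        fun p => Function.update p.1 n p.2) ∪
      (nonskipSequences k n c ×ˢ Finset.Ico (n + 1 - c) (k + n + 1)).image
        fun p => Function.update p.1 n p.2

theorem mem_nonskipSequences {k n : ℕ} {a : ℕ → ℕ} (h : ∀ i < n, a i < k + i + 1) :
    (fun i => if i < n then a i else 0) ∈ nonskipSequences k n (greedySkips a n) := by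
  classical
  induction n with
  | zero =>
    rw [greedySkips, nonskipSequences, Finset.mem_singleton]
    rfl
  | succ n ih =>
    have hprev := ih fun i hi => h i (hi.trans (Nat.lt_succ_self n))
    have hn := h n (Nat.lt_succ_self n)
    have hupd : (fun i => if i < n + 1 then a i else 0) =
        Function.update (fun i => if i < n then a i else 0) n (a n) := by
      funext i
      rcases eq_or_ne i n with rfl | hi
      · simp
      · rw [Function.update_of_ne hi]
        have : i < n + 1 ↔ i < n := by omega
        simp only [this]
    rw [hupd, greedySkips]
    set g := greedySkips a n
    split_ifs with hs
    · rw [nonskipSequences, Finset.mem_union]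
      exact Or.inr (Finset.mem_image.2 ⟨(_, a n), Finset.mem_product.2
        ⟨hprev, Finset.mem_Ico.2 ⟨hs, by omega⟩⟩, rfl⟩)
    · rw [add_zero]
      cases hg : g with
      | zero =>
        rw [nonskipSequences]
        exact Finset.mem_image.2 ⟨(_, a n), Finset.mem_product.2
          ⟨hg ▸ hprev, Finset.mem_range.2 (by omega)⟩, rfl⟩
      | succ c =>
        rw [nonskipSequences, Finset.mem_union]
        exact Or.inl (Finset.mem_image.2 ⟨(_, a n), Finset.mem_product.2
          ⟨hg ▸ hprev, Finset.mem_range.2 (by omega)⟩, rfl⟩)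

theorem add_mul_multichoose (k c : ℕ) :
    (k + c) * k.multichoose c = (c + 1) * k.multichoose (c + 1) := by
  cases k with
  | zero =>
    cases c with
    | zero => simp
    | succ c => simp
  | succ k =>
    rw [Nat.multichoose_eq, Nat.multichoose_eq, show k + 1 + c - 1 = k + c by omega,
      show k + 1 + (c + 1) - 1 = k + c + 1 by omega, mul_comm (c + 1),
      ← Nat.add_one_mul_choose_eq, show k + 1 + c = k + c + 1 by omega]

theorem sum_multichoose (k p : ℕ) :
    ∑ c ∈ Finset.range (p + 1), k.multichoose c = (k + 1).multichoose p := by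
  induction p with
  | zero => simp
  | succ p ih => rw [Finset.sum_range_succ, ih, Nat.multichoose_succ_succ, add_comm]

theorem card_nonskipSequences_le (k n c : ℕ) (hc : c ≤ n) :
    (nonskipSequences k n c).card ≤ n.factorial * k.multichoose c := by
  classical
  induction n generalizing c with
  | zero =>
    obtain rfl := Nat.le_zero.1 hc
    simp [nonskipSequences]
  | succ n ih =>
    cases c with
    | zero =>
      rw [nonskipSequences]
      refine Finset.card_image_le.trans ?_
      rw [Finset.card_product, Finset.card_range, Nat.factorial_succ]
      have := ih 0 (Nat.zero_le n)
      rw [Nat.multichoose_zero_right, mul_one] at this ⊢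
      rw [mul_comm]
      exact Nat.mul_le_mul_left _ this
    | succ c =>
      have hcn : c ≤ n := Nat.le_of_succ_le_succ hc
      rw [nonskipSequences]
      refine (Finset.card_union_le _ _).trans
        ((add_le_add Finset.card_image_le Finset.card_image_le).trans ?_)
      rw [Finset.card_product, Finset.card_product, Finset.card_range, Nat.card_Ico,
        show k + n + 1 - (n + 1 - c) = k + c by omega, Nat.factorial_succ]
      have h1 := Nat.mul_le_mul_right (k + c) (ih c hcn)
      have h2 : (nonskipSequences k n (c + 1)).card * (n - c) ≤
          n.factorial * k.multichoose (c + 1) * (n - c) := by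
        rcases hcn.eq_or_lt with rfl | hlt
        · simp
        · exact Nat.mul_le_mul_right _ (ih (c + 1) hlt)
      refine (add_le_add h2 h1).trans (le_of_eq ?_)
      obtain ⟨d, rfl⟩ := Nat.exists_eq_add_of_le hcn
      rw [Nat.add_sub_cancel_left]
      have := add_mul_multichoose k c
      linear_combination (c + d).factorial * this

open Classical in
/-- The exponents of `n` variables with `u_i < k + i` (counting from `i = 1`) for which the greedy
search selects at most `p` positions. -/
noncomputable def nonskipExponents (n k p : ℕ) : Finset (Fin n →₀ ℕ) :=
  ((Finset.range (p + 1)).biUnion (nonskipSequences k n)).image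
    fun a => Finsupp.equivFunOnFinite.symm fun i : Fin n => a i

theorem card_nonskipExponents_le {n k p : ℕ} (hp : p ≤ n) :
    (nonskipExponents n k p).card ≤ n.factorial * (p + k).choose p := by
  classical
  refine Finset.card_image_le.trans (Finset.card_biUnion_le.trans ?_)
  refine (Finset.sum_le_sum fun c hc => card_nonskipSequences_le k n c ?_).trans ?_
  · have := Finset.mem_range.1 hc
    omega
  · rw [← Finset.mul_sum, sum_multichoose, Nat.multichoose_eq, show k + 1 + p - 1 = p + k by omega]

theorem mem_nonskipExponents {n k p : ℕ} {u : Fin n →₀ ℕ} (h1 : ∀ i, u i < k + (i + 1))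
    (h2 : ∀ S : Finset (Fin n), S.card = p + 1 → ∃ i, u i < skipVector S i) :
    u ∈ nonskipExponents n k p := by
  classical
  let a : ℕ → ℕ := fun i => if h : i < n then u ⟨i, h⟩ else 0
  have ha : ∀ i : Fin n, a i = u i := fun i => dif_pos i.2
  have hg : greedySkips a n < p + 1 := by
    by_contra hlt
    obtain ⟨S, hS, hle⟩ := exists_skipVector_le (not_lt.1 hlt)
    obtain ⟨i, hi⟩ := h2 S hS
    have := hle i
    rw [ha] at this
    omega
  have hmem := mem_nonskipSequences (k := k) (n := n) (a := a) fun i hi => by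
    rw [ha ⟨i, hi⟩]
    exact h1 ⟨i, hi⟩
  refine Finset.mem_image.2 ⟨_, Finset.mem_biUnion.2 ⟨_, Finset.mem_range.2 hg, hmem⟩, ?_⟩
  ext i
  simp [ha]

end

/-! ### The Gröbner basis -/

section
variable {n k r : ℕ}

theorem mem_nonskipExponents_of_not_degree_le {u : Fin n →₀ ℕ}
    (h : ∀ a, ¬ MonomialOrder.lex.degree (mixedGroebnerFamily n k r a) ≤ u) :
    u ∈ nonskipExponents n k (n - r) := by
  refine mem_nonskipExponents (fun i => ?_) fun S hS => ?_
  · have := h (.inl i)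
    rwa [degree_mixedGroebnerFamily_inl, Finsupp.single_le_iff, not_le] at this
  · by_contra! hle
    refine h (.inr ⟨S, hS⟩) fun i => ?_
    rw [degree_mixedGroebnerFamily_inr]
    exact hle i

/-- The standard exponents are exactly the nonskip exponents: there are at least as many of them as
points, and at most as many nonskip exponents. -/
theorem standardExponents_mixedIdeal (hr : r ≤ n) :
    standardExponents MonomialOrder.lex (mixedIdeal n k r) = nonskipExponents n k (n - r) := by
  refine standardExponents_eq_of_card_le (pt := (injectionPoint : RestrictedInjection n k r → _))
    injectionPoint_injective _ ?_ ?_ ((card_nonskipExponents_le (Nat.sub_le n r)).trans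
      (le_card_restrictedInjection hr))
  · rintro g (⟨d, hd, rfl⟩ | ⟨d, hd, rfl⟩)
    · exact ⟨d, isHomogeneous_hsymm d, exists_lower_hsymm hd.1⟩
    · exact ⟨d, isHomogeneous_esymm d, exists_lower_esymm hr hd.1⟩
  · intro u hu
    refine Finset.mem_coe.2 (mem_nonskipExponents_of_not_degree_le (r := r) fun a ha => ?_)
    have hg0 := (monic_mixedGroebnerFamily (k := k) a).ne_zero
    have hm0 : (monomial (u - MonomialOrder.lex.degree (mixedGroebnerFamily n k r a)) (1 : ℚ)) ≠
        0 := by simp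
    refine hu _ (Ideal.mul_mem_left _ (monomial (u - MonomialOrder.lex.degree
      (mixedGroebnerFamily n k r a)) 1) (mixedGroebnerFamily_mem a)) (mul_ne_zero hm0 hg0) ?_
    rw [MonomialOrder.degree_mul hm0 hg0, MonomialOrder.degree_monomial, if_neg one_ne_zero,
      tsub_add_cancel_of_le ha]

theorem exists_degree_le (hr : r ≤ n) {f : MvPolynomial (Fin n) ℚ} (hf : f ∈ mixedIdeal n k r)
    (hf0 : f ≠ 0) : ∃ a, MonomialOrder.lex.degree (mixedGroebnerFamily n k r a) ≤
      MonomialOrder.lex.degree f := by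
  by_contra! h
  have hmem := mem_nonskipExponents_of_not_degree_le h
  rw [← Finset.mem_coe, ← standardExponents_mixedIdeal hr] at hmem
  exact hmem f hf hf0 rfl

theorem leadingTerm_mixedGroebnerFamily (a) :
    MonomialOrder.lex.leadingTerm (mixedGroebnerFamily n k r a) =
      monomial (MonomialOrder.lex.degree (mixedGroebnerFamily n k r a)) 1 := by
  rw [MonomialOrder.leadingTerm, (monic_mixedGroebnerFamily a).leadingCoeff_eq_one]

theorem isGroebnerBasis_mixedGroebnerFamily (hr : r ≤ n) :
    IsGroebnerBasis MonomialOrder.lex (mixedIdeal n k r) (mixedGroebnerFamily n k r) where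
  mem := mixedGroebnerFamily_mem
  ne_zero a := (monic_mixedGroebnerFamily a).ne_zero
  initialIdeal_eq := by
    refine le_antisymm (Ideal.span_le.2 ?_) (Ideal.span_le.2 ?_)
    · rintro t ⟨f, hf, hf0, rfl⟩
      obtain ⟨a, ha⟩ := exists_degree_le hr hf hf0
      refine Ideal.mem_of_dvd _ ?_ (Ideal.subset_span ⟨a, rfl⟩)
      simp only [leadingTerm_mixedGroebnerFamily]
      exact monomial_dvd_monomial.2 ⟨Or.inr ha, one_dvd _⟩
    · rintro t ⟨a, rfl⟩
      exact Ideal.subset_span ⟨_, mixedGroebnerFamily_mem a,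
        (monic_mixedGroebnerFamily a).ne_zero, rfl⟩

theorem skipVector_pos_iff {S : Finset (Fin n)} {i : Fin n} : 0 < skipVector S i ↔ i ∈ S := by
  rw [skipVector]
  split_ifs with h
  · refine iff_of_true ?_ h
    have : (S.filter (· < i)).card ≤ i := by
      refine (Finset.card_le_card (t := Finset.Iio i) fun x hx =>
        Finset.mem_Iio.2 (Finset.mem_filter.1 hx).2).trans ?_
      rw [Fin.card_Iio]
    omega
  · exact iff_of_false (lt_irrefl 0) h

theorem skipVector_le (S : Finset (Fin n)) (i : Fin n) : skipVector S i ≤ i + 1 := by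
  rw [skipVector]
  split_ifs
  · exact Nat.sub_le _ _
  · exact Nat.zero_le _

theorem not_degree_le_of_ne (hr : r < n) (hk : 0 < k)
    {a b : Fin n ⊕ {S : Finset (Fin n) // S.card = n - r + 1}} (hab : a ≠ b) :
    ¬ MonomialOrder.lex.degree (mixedGroebnerFamily n k r a) ≤
      MonomialOrder.lex.degree (mixedGroebnerFamily n k r b) := by
  intro hle
  rcases a with i | S
  · rw [degree_mixedGroebnerFamily_inl, Finsupp.single_le_iff] at hle
    rcases b with j | T
    · rw [degree_mixedGroebnerFamily_inl, Finsupp.single_apply, if_neg] at hle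
      · omega
      · rintro rfl
        exact hab rfl
    · rw [degree_mixedGroebnerFamily_inr] at hle
      have := skipVector_le T.1 i
      omega
  · have hle' := fun x => hle x
    simp only [degree_mixedGroebnerFamily_inr] at hle'
    rcases b with j | T
    · -- The set `S` has at least two elements, but only the exponent of `x_j` is positive.
      obtain ⟨x, hx, hxj⟩ := Finset.exists_mem_ne (by rw [S.2]; omega : 1 < S.1.card) j
      have h1 := skipVector_pos_iff.2 hx
      have h2 := hle' x
      rw [degree_mixedGroebnerFamily_inl, Finsupp.single_apply, if_neg hxj.symm] at h2
      omega
    · simp only [degree_mixedGroebnerFamily_inr] at hle'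
      refine hab (congrArg Sum.inr (Subtype.ext (Finset.eq_of_subset_of_card_le (fun x hx => ?_)
        (by rw [S.2, T.2]))))
      exact skipVector_pos_iff.1 ((skipVector_pos_iff.2 hx).trans_le (hle' x))

end

theorem mainTheorem7 (n k r : ℕ) (hr : r ≤ n) :
    IsGroebnerBasis MonomialOrder.lex (mixedIdeal n k r) (mixedGroebnerFamily n k r) ∧
      (r < n → 0 < k →
        IsMinimalGroebnerBasis MonomialOrder.lex (mixedIdeal n k r)
          (mixedGroebnerFamily n k r)) := by
  refine ⟨isGroebnerBasis_mixedGroebnerFamily hr, fun hrn hk =>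
    { isGroebnerBasis_mixedGroebnerFamily hr with
      leadingCoeff_eq_one := fun a => (monic_mixedGroebnerFamily a).leadingCoeff_eq_one
      not_dvd := fun a b hab hdvd => ?_ }⟩
  rw [leadingTerm_mixedGroebnerFamily, leadingTerm_mixedGroebnerFamily, monomial_dvd_monomial]
    at hdvd
  exact not_degree_le_of_ne hrn hk hab (hdvd.1.resolve_left one_ne_zero)
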